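/- **Model.** A radio network is a finite directed graph with $n\ge 2$ nodes that is strongly connected; an undirected (connected) network is the special case of a symmetric edge relation. $D$ is its eccentricity, the maximum distance between any two nodes. Every node knows $n$ and $D$, but nothing about the topology. Time is divided into synchronous steps. In a step a node either transmits a message to all its out-neighbours or listens. A listening node receives a message if and only if exactly one of its in-neighbours transmits in this step; otherwise it receives nothing (no collision detection). Nodes use private independent coins. Fix a constant $c\ge 1$ (an integer), write $\ell=\lceil\log_2 n\rceil$ and $\lambda=\lfloor\log_2\lfloor n/D\rfloor\rfloor+1$, and let messages be bit strings of length $16c\,\ell$. **Decay** with height $h\le \ell$ and a set $S$ of participants takes $h$ steps; in step $i=1,\dots,h$ each $u\in S$ transmits its message with probability $2^{-i}$, independently. **Partial multi-broadcast** with a set of sources, each holding a string, consists of $Q=K(D+\ell g)$ successive rounds of Decay, where $K$ is a constant and $g=\lfloor \ell/\lambda\rfloor+1$. Round $q=0,\dots,Q-1$ has height $\ell$ if $g\mid q$, and height $\min(\ell,\lambda+\nu_2(q+1))$ otherwise, where $\nu_2(k)$ is the exponent of $2$ in $k$. In each round all nodes that hold a string at its beginning participate with it, and a node without a string adopts the first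 one that it receives. The result at $v$ is the string that $v$ holds at the end ($\epsilon$ if none). **Selection** with a set $C$ of candidates with IDs: (1) $m(v)\gets$ partial multi-broadcast of the IDs from $C$. A node with $m(v)=\epsilon$ stops with output $(\epsilon,0)$. (2) For each bit position $i=1,\dots,16c\,\ell$, the nodes with $m(v)_i=1$ perform four rounds of Decay of height $\ell$ with message $m(v)$; a node with $m(v)_i=0$ that receives a string becomes a witness and replaces $m(v)$ by the larger of $m(v)$ and the (first) string received. (3) $p(v)\gets$ partial multi-broadcast of the strings $m(w)$ from the witnesses $w$. If $p(v)=\epsilon$ then $v$ outputs $(m(v),1)$, else $(p(v),0)$. **Leader election.** Each node repeats: it becomes a candidate with probability $1/n$; if it is a candidate, it chooses a uniformly random $16c\,\ell$-bit ID; all random choices are independent. Then $(m(v),b)\gets$ Selection. If $b=1$, then $v$ outputs $m(v)$ and terminates (and is silent from then on). The running time is the number of time steps until all nodes have terminated. A leader is correctly elected if all nodes terminate with the same output, and exactly one node has this output as its own ID (in the iteration in which it terminates). **Theorem.** For every integer $c\ge 1$ there are constants $K$ and $A$ such that on every strongly connected network with $n\ge2$ nodes and eccentricity $D$, directed or undirected,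 the expected running time of this algorithm is at most $$A\cdot\Bigl(D\,\max\bigl(1,\log_2\tfrac nD\bigr)+\log_2^2 n\Bigr)$$ (thus it is $O(D\log\frac nD+\log^2 n)$, with $\log\frac nD$ read as at least $1$), and with probability at least $1-n^{-c}$ it correctly elects a leader. -/

import Mathlib

open MeasureTheory
open scoped ENNReal

namespace RadioLE

universe u

/-! ### Networks

A network is a finite digraph; `G.Adj u v` means that `u` can send to `v`. An undirected network is
a digraph with a symmetric adjacency relation. -/

/-- Every node can be reached from every node along directed edges. -/
def StronglyConnected {V : Type u} (G : Digraph V) : Prop :=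
  ∀ u v : V, Relation.ReflTransGen G.Adj u v

/-- The length of a shortest directed walk from `u` to `v`. -/
noncomputable def hopDist {V : Type u} (G : Digraph V) (u v : V) : ℕ :=
  sInf {k : ℕ | ∃ p : ℕ → V, p 0 = u ∧ p k = v ∧ ∀ i < k, G.Adj (p i) (p (i + 1))}

/-- The eccentricity `D` of the network: the maximum distance between any two nodes. -/
noncomputable def eccentricity {V : Type u} [Fintype V] (G : Digraph V) : ℕ :=
  Finset.univ.sup fun u : V => Finset.univ.sup fun v : V => hopDist G u v

/-! ### One time step of the radio model without collision detection -/

open Classical in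
/-- `tx u = some x` means that `u` transmits `x` in this time step, `tx u = none` that it listens.
A node `v` receives a message iff it listens and exactly one of its in-neighbours transmits;
otherwise it receives nothing (`none`), whether zero or several in-neighbours transmit. -/
noncomputable def receive {V : Type u} {M : Type} (G : Digraph V) (tx : V → Option M) (v : V) :
    Option M :=
  if h : tx v = none ∧ ∃! u, G.Adj u v ∧ (tx u).isSome then tx h.2.exists.choose else none

/-- Bit strings of length `b`, used as identifiers and as messages. -/
abbrev BitString (b : ℕ) : Type := Fin b → Bool

/-- The larger of two bit strings, read as binary numbers with the most significant bit first. -/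
noncomputable def maxString {b : ℕ} (x y : BitString b) : BitString b :=
  ofLex (max (toLex x) (toLex y))

/-! ### Decay -/

/-- The coins of the nodes for one round of Decay: before step `i` (counted from `0`) node `v`
tosses the coin `coins v i`, which shows `true` with probability `2 ^ (-(i + 1))`. -/
abbrev DecayCoins (V : Type u) (l : ℕ) : Type u := V → Fin l → Bool

/-- One round of Decay, cut off after the first `h` of its `l` steps. The participants are the nodes
`u` with `msg u ≠ none`; in step `i` a participant transmits its message iff its coin for this
step shows `true`. The value at `v` is the first message that `v` receives, if any. -/
noncomputable def decay {V : Type u} {M : Type} {l : ℕ} (G : Digraph V) (h : ℕ)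
    (msg : V → Option M) (coins : DecayCoins V l) (v : V) : Option M :=
  (List.finRange l).findSome? fun i =>
    if i.val < h then receive G (fun u => if coins u i then msg u else none) v else none

/-! ### Partial multi-broadcast -/

/-- Partial multi-broadcast. The nodes that take part are those with `part v = true`; the sources
are the nodes with `f v ≠ none`. It consists of `Q` rounds of Decay, where round `q` is cut off
after `h q` steps. In each round all nodes that hold a message at its beginning participate with
that message; a node without a message adopts the first one that it receives and keeps it.
The value is the string `m(v)` interpreted by `v`, with `none` for the empty string. -/
noncomputable def multiBroadcast {V : Type u} {M : Type} {l Q : ℕ} (G : Digraph V) (h : ℕ → ℕ)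
    (part : V → Bool) (f : V → Option M) (coins : Fin Q → DecayCoins V l) : V → Option M :=
  (List.finRange Q).foldl
    (fun m (q : Fin Q) v => (m v).or (if part v then decay G (h q.val) m (coins q) v else none)) f

/-! ### Selection -/

/-- Iteration `j` of the loop of Selection. The state gives the current string `m(v)` of each node
and the set of witnesses. The nodes whose string has bit `j` equal to `1` perform four rounds of
Decay with their string; a node which has a string with bit `j` equal to `0` and receives a
string becomes a witness and keeps the larger of the two. -/
noncomputable def conflictStep {V : Type u} {b l : ℕ} (G : Digraph V) (j : Fin b)
    (coins : Fin 4 → DecayCoins V l) (s : V → Option (BitString b) × Bool) :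
    V → Option (BitString b) × Bool := fun v =>
  match (s v).1 with
  | none => s v
  | some x =>
    let heard : Option (BitString b) := (List.finRange 4).findSome? fun r =>
      decay G l (fun u => (s u).1.filter fun y => y j) (coins r) v
    match x j, heard with
    | false, some y => (some (maxString x y), true)
    | _, _ => s v

/-- Selection, performed by the nodes with `act v = true`, where `ids v` is the identifier of `v` if
`v` is a candidate and `none` otherwise. The value at `v` is the pair `(m(v), b)`. Nodes that
hold the empty string after the first broadcast stop there with output `(ε, 0)`. -/
noncomputable def selection {V : Type u} {b l Q : ℕ} (G : Digraph V) (h : ℕ → ℕ)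
    (act : V → Bool) (ids : V → Option (BitString b)) (coins₁ : Fin Q → DecayCoins V l)
    (coins₂ : Fin b → Fin 4 → DecayCoins V l) (coins₃ : Fin Q → DecayCoins V l) :
    V → Option (BitString b) × Bool :=
  let m₀ : V → Option (BitString b) := multiBroadcast G h act ids coins₁
  let s : V → Option (BitString b) × Bool :=
    (List.finRange b).foldl (fun s j => conflictStep G j (coins₂ j) s) fun v => (m₀ v, false)
  let p : V → Option (BitString b) :=
    multiBroadcast G h (fun v => (m₀ v).isSome) (fun v => if (s v).2 then (s v).1 else none) coins₃
  fun v =>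
    match m₀ v, p v with
    | none, _ => (none, false)
    | some _, none => ((s v).1, true)
    | some _, some y => (some y, false)

/-! ### Parameters known to all nodes: functions of `n`, `D` and the constants `c`, `K` -/

/-- `log n`, rounded up. -/
def logSize (n : ℕ) : ℕ := Nat.clog 2 n

/-- `max 1 (log (n / D))`, up to rounding. -/
def logRatio (n D : ℕ) : ℕ := Nat.log 2 (n / D) + 1

/-- The length `16 c log n` of the identifiers. -/
def idLength (c n : ℕ) : ℕ := 16 * c * logSize n

/-- Every so many rounds, the broadcast performs a full round of Decay. -/
def fullPeriod (n D : ℕ) : ℕ := logSize n / logRatio n D + 1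

/-- The number of rounds of Decay in one broadcast. -/
def numRounds (K n D : ℕ) : ℕ := K * (D + logSize n * fullPeriod n D)

/-- The number of steps of round `q` of a broadcast, so that a transmission probability `2 ^ (-k)`
is used in every round if `k ≤ log (n / D)`, in one out of `2 ^ j` rounds if
`k = log (n / D) + j`, and at least once in `O(log n)` steps in any case. -/
def roundHeight (n D q : ℕ) : ℕ :=
  if q % fullPeriod n D = 0 then logSize n
  else min (logSize n) (logRatio n D + padicValNat 2 (q + 1))

/-- The number of time steps of a partial multi-broadcast. -/
def broadcastSteps (K n D : ℕ) : ℕ := ∑ q ∈ Finset.range (numRounds K n D), roundHeight n D q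

/-- The number of time steps of one iteration of the main loop: two partial multi-broadcasts, and
four rounds of Decay for each bit of an identifier. -/
def iterationSteps (c K n D : ℕ) : ℕ :=
  2 * broadcastSteps K n D + idLength c n * 4 * logSize n

/-! ### Randomness -/

/-- A coin that shows `true` with probability `1 / k` and `false` otherwise (`k` positive). -/
noncomputable def coin (k : ℕ) : Measure Bool :=
  ProbabilityTheory.bernoulliMeasure true false
    ⟨(k : ℝ)⁻¹, inv_nonneg.mpr k.cast_nonneg, Nat.cast_inv_le_one k⟩

instance (k : ℕ) : IsProbabilityMeasure (coin k) := by
  unfold coin; infer_instance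

/-- The coins of all nodes in one iteration of the main loop. The components say which nodes become
candidates, which identifier each node uses if it is a candidate, and give the coins for the
first broadcast, for the detection of conflicts and for the second broadcast. -/
abbrev IterationCoins (V : Type u) (b l Q : ℕ) : Type u :=
  (V → Bool) × (V → BitString b) × (Fin Q → DecayCoins V l) ×
    (Fin b → Fin 4 → DecayCoins V l) × (Fin Q → DecayCoins V l)

/-- The law of the coins for one round of Decay. All coins of all nodes are independent. -/
noncomputable def decayLaw (V : Type u) [Fintype V] (l : ℕ) : Measure (DecayCoins V l) :=
  Measure.pi fun _ => Measure.pi fun i => coin (2 ^ (i.val + 1))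

instance (V : Type u) [Fintype V] (l : ℕ) : IsProbabilityMeasure (decayLaw V l) := by
  unfold decayLaw; infer_instance

/-- The law of the coins of one iteration: every node becomes a candidate with probability
`1 / n`, identifiers are uniform, and everything is independent. -/
noncomputable def iterationLaw (V : Type u) [Fintype V] (n b l Q : ℕ) :
    Measure (IterationCoins V b l Q) :=
  (Measure.pi fun _ => coin n).prod <|
  (Measure.pi fun _ => Measure.pi fun _ => coin 2).prod <|
  (Measure.pi fun _ => decayLaw V l).prod <|
  (Measure.pi fun _ => Measure.pi fun _ => decayLaw V l).prod <|
  Measure.pi fun _ => decayLaw V l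

instance (V : Type u) [Fintype V] (n b l Q : ℕ) : IsProbabilityMeasure (iterationLaw V n b l Q) := by
  unfold iterationLaw; infer_instance

/-- The coins of all nodes in all iterations of the main loop. -/
abbrev Coins (V : Type u) (b l Q : ℕ) : Type u := ℕ → IterationCoins V b l Q

/-- The law of all coins: the iterations are independent. -/
noncomputable def coinLaw (V : Type u) [Fintype V] (n b l Q : ℕ) : Measure (Coins V b l Q) :=
  Measure.infinitePi fun _ => iterationLaw V n b l Q

instance (V : Type u) [Fintype V] (n b l Q : ℕ) : IsProbabilityMeasure (coinLaw V n b l Q) := by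
  unfold coinLaw; infer_instance

/-! ### Leader election -/

/-- The status of a node: `none` as long as it is running, and `some (y, own)` once it has
terminated, where `y` is its output and `own` is the identifier that it had in the iteration in
which it terminated (`none` if it was not a candidate then). -/
abbrev Status (b : ℕ) : Type := Option (BitString b × Option (BitString b))

/-- One iteration of the main loop. Nodes that have terminated remain silent. -/
noncomputable def iteration {V : Type u} {b l Q : ℕ} (G : Digraph V) (h : ℕ → ℕ)
    (st : V → Status b) (r : IterationCoins V b l Q) : V → Status b :=
  let act : V → Bool := fun v => (st v).isNone
  let ids : V → Option (BitString b) := fun v => if act v && r.1 v then some (r.2.1 v) else none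
  let sel := selection G h act ids r.2.2.1 r.2.2.2.1 r.2.2.2.2
  fun v =>
    if act v then
      match sel v with
      | (some y, true) => some (y, ids v)
      | _ => none
    else st v

/-- The status of the nodes after `k` iterations. -/
noncomputable def run {V : Type u} {b l Q : ℕ} (G : Digraph V) (h : ℕ → ℕ) (ω : Coins V b l Q) :
    ℕ → V → Status b
  | 0 => fun _ => none
  | k + 1 => iteration G h (run G h ω k) (ω k)

/-- The number of time steps until all nodes have terminated (`∞` if this never happens), where each
iteration takes `T` time steps. -/
noncomputable def runningTime {V : Type u} {b l Q : ℕ} (G : Digraph V) (h : ℕ → ℕ) (T : ℕ)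
    (ω : Coins V b l Q) : ℝ≥0∞ :=
  ⨅ (k : ℕ) (_ : ∀ v, (run G h ω k v).isSome), ((T * k : ℕ) : ℝ≥0∞)

/-- All nodes terminate with the same output, and exactly one node has this output as its own
identifier. -/
def ElectsLeader {V : Type u} {b l Q : ℕ} (G : Digraph V) (h : ℕ → ℕ) (ω : Coins V b l Q) :
    Prop :=
  ∃ (k : ℕ) (y : BitString b),
    (∀ v, ∃ own, run G h ω k v = some (y, own)) ∧ ∃! v, run G h ω k v = some (y, some y)

/-- The law of the coins of the algorithm with constants `c` and `K` on the nodes `V` of a network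
of size `n` and eccentricity `D`. -/
noncomputable def algorithmLaw (c K n D : ℕ) (V : Type u) [Fintype V] :
    Measure (Coins V (idLength c n) (logSize n) (numRounds K n D)) :=
  coinLaw V n _ _ _

end RadioLE

/-!
*Broadcast.* Fix a shortest path `p 0, …, p d` from a source to a node, and let the front be the
last node of the path with an informed in-neighbour. All informed in-neighbours of the front have
it as their last out-neighbour on the path, so the sets of nodes that can compete at different
fronts are disjoint. A round of Decay whose height is at least the logarithm of the number `k` of
competitors informs the front with probability at least `0.18`. Such a round occurs about every
`min g (1 + k * D / n)` rounds, where `g` is the period of the full rounds, and these gaps add up to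
at most `3 * D` along the path. A supermartingale that grows at rate `1 / (10 * g)` per round bounds
the probability of failure after `K * (D + g * log n)` rounds by `exp (-K * log n / 10)`.

*Conflicts.* If all nodes are informed, but not by the same string, then two different strings meet
across an edge. For random strings, each bit is with probability `1 / 4` such that the sender has
`1` and the receiver `0`, and then four full rounds of Decay miss the conflict with probability at
most `0.82 ^ 4`. Over all `16 * c * log n` bits this gives `n ^ (-3 * c)`, up to a constant factor,
for a fixed pair of strings. A fixed pair of nodes is a pair of candidates with probability
`1 / n ^ 2`, which pays for the union bound over all pairs.

*Iterations.* From the initial state, an iteration elects a leader with probability at least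
`0.32`, since exactly one candidate suffices, and it ends neither there nor in the initial state
with probability `O(n ^ (-3 * c))`. From any other state, each running node is with probability
more than `1 / (3 * n)` the only candidate, and then it terminates, so at most `3 * n ^ 2` further
iterations are expected. The drift of two potentials turns this into a bound of `8` for the expected
number of iterations and of `n ^ (-c)` for the probability of an error.
-/

namespace RadioLE

open ProbabilityTheory

/-! ### Potentials along sequences of independent trials -/

section Potential

variable {X σ : Type*}

/-- The trajectory from `s` of the system with transition function `step` and inputs `ω`. -/
def chain (step : σ → X → σ) (s : σ) (ω : ℕ → X) : ℕ → σ
  | 0 => s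
  | k + 1 => step (chain step s ω k) (ω k)

theorem dependsOn_chain (step : σ → X → σ) (s : σ) (k : ℕ) :
    DependsOn (fun ω => chain step s ω k) (Finset.range k) := by
  induction k with
  | zero => exact fun _ _ _ => rfl
  | succ k ih =>
    intro ω ω' h
    have hk : ω k = ω' k := h k (by simp)
    have hchain : chain step s ω k = chain step s ω' k :=
      ih fun i hi => h i (by simp only [Finset.mem_coe, Finset.mem_range] at hi ⊢; omega)
    simp only [chain, hk, hchain]

variable [MeasurableSpace X] [Countable X] [MeasurableSingletonClass X] (μ : Measure X)

theorem lintegral_foldl_finRange_le [SigmaFinite μ] {Q : ℕ} (step : Fin Q → σ → X → σ)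
    (Φ : ℕ → σ → ℝ≥0∞) (hΦ : ∀ (q : Fin Q) s, ∫⁻ x, Φ (q + 1) (step q s x) ∂μ ≤ Φ q s)
    (s : σ) :
    ∫⁻ x : Fin Q → X, Φ Q ((List.finRange Q).foldl (fun s q => step q s (x q)) s)
      ∂(Measure.pi fun _ => μ) ≤ Φ 0 s := by
  induction Q generalizing s Φ with
  | zero => simp
  | succ Q ih =>
    have split := (measurePreserving_piFinSuccAbove (fun _ : Fin (Q + 1) => μ) 0).symm
    rw [← split.lintegral_comp_emb (MeasurableEquiv.measurableEmbedding _),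
      lintegral_prod _ Measurable.of_discrete.aemeasurable]
    refine (lintegral_mono fun x => ?_).trans (hΦ 0 s)
    refine (lintegral_congr fun y => ?_).trans_le
      (ih (fun q => step q.succ) (fun q => Φ (q + 1)) (fun q => hΦ q.succ) (step 0 s x))
    simp only [List.finRange_succ, List.foldl_cons, List.foldl_map]
    rfl

theorem measurable_chain [MeasurableSpace σ] [Countable σ] [MeasurableSingletonClass σ]
    (step : σ → X → σ) (s : σ) (k : ℕ) : Measurable fun ω => chain step s ω k := by
  induction k with
  | zero => exact measurable_const
  | succ k ih =>
    exact (Measurable.of_discrete (f := fun z : σ × X => step z.1 z.2)).comp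
      (ih.prodMk (measurable_pi_apply k))

variable [IsProbabilityMeasure μ]

theorem indepFun_chain_eval [MeasurableSpace σ] (step : σ → X → σ) (s : σ) (k : ℕ) :
    IndepFun (fun ω => chain step s ω k) (fun ω => ω k) (Measure.infinitePi fun _ : ℕ => μ) := by
  have hind : iIndepFun (fun (i : ℕ) (ω : ℕ → X) => ω i) (Measure.infinitePi fun _ => μ) :=
    iIndepFun_infinitePi (X := fun _ x => x) fun _ => measurable_id
  have : Nonempty σ := ⟨s⟩
  obtain ⟨g, hg⟩ := dependsOn_iff_exists_comp.1 (dependsOn_chain (X := X) step s k)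
  have hmeas : Measurable g := Measurable.of_discrete
  rw [hg]
  exact (hind.indepFun_finset (Finset.range k) {k} (by simp) measurable_pi_apply).comp
    hmeas (measurable_pi_apply (⟨k, by simp⟩ : ({k} : Finset ℕ)))

variable [Countable σ]

theorem lintegral_chain_succ (step : σ → X → σ) (s : σ) (Φ : σ → ℝ≥0∞) (k : ℕ) :
    ∫⁻ ω, Φ (chain step s ω (k + 1)) ∂(Measure.infinitePi fun _ : ℕ => μ) =
      ∫⁻ ω, ∫⁻ x, Φ (step (chain step s ω k) x) ∂μ ∂(Measure.infinitePi fun _ : ℕ => μ) := by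
  let _ : MeasurableSpace σ := ⊤
  have hchain := measurable_chain (X := X) step s k
  have hjoint := (indepFun_chain_eval μ step s k).map_prod_eq_prod_map_map hchain.aemeasurable
    (measurable_pi_apply k).aemeasurable
  rw [Measure.infinitePi_map_eval] at hjoint
  calc ∫⁻ ω, Φ (chain step s ω (k + 1)) ∂(Measure.infinitePi fun _ : ℕ => μ)
      = ∫⁻ z : σ × X, Φ (step z.1 z.2)
          ∂((Measure.infinitePi fun _ : ℕ => μ).map fun ω => (chain step s ω k, ω k)) :=
        (lintegral_map (f := fun z : σ × X => Φ (step z.1 z.2)) Measurable.of_discrete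
          (hchain.prodMk (measurable_pi_apply k))).symm
    _ = ∫⁻ t, ∫⁻ x, Φ (step t x) ∂μ
          ∂((Measure.infinitePi fun _ : ℕ => μ).map fun ω => chain step s ω k) := by
        rw [hjoint, lintegral_prod _ Measurable.of_discrete.aemeasurable]
    _ = _ := lintegral_map Measurable.of_discrete hchain

theorem lintegral_chain_le (step : σ → X → σ) (s : σ) (Φ : σ → ℝ≥0∞)
    (hΦ : ∀ s, ∫⁻ x, Φ (step s x) ∂μ ≤ Φ s) (k : ℕ) :
    ∫⁻ ω, Φ (chain step s ω k) ∂(Measure.infinitePi fun _ : ℕ => μ) ≤ Φ s := by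
  induction k with
  | zero => simp [chain]
  | succ k ih =>
    rw [lintegral_chain_succ]
    exact (lintegral_mono fun ω => hΦ _).trans ih

theorem tsum_lintegral_chain_le (step : σ → X → σ) (s : σ) (cost Φ : σ → ℝ≥0∞)
    (hΦ : ∀ s, cost s + ∫⁻ x, Φ (step s x) ∂μ ≤ Φ s) :
    ∑' k, ∫⁻ ω, cost (chain step s ω k) ∂(Measure.infinitePi fun _ : ℕ => μ) ≤ Φ s := by
  let _ : MeasurableSpace σ := ⊤
  have hpartial : ∀ N, ∑ k ∈ Finset.range N,
        ∫⁻ ω, cost (chain step s ω k) ∂(Measure.infinitePi fun _ : ℕ => μ) +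
      ∫⁻ ω, Φ (chain step s ω N) ∂(Measure.infinitePi fun _ : ℕ => μ) ≤ Φ s := by
    intro N
    induction N with
    | zero => simp [chain]
    | succ N ih =>
      have hcost : Measurable fun ω => cost (chain (X := X) step s ω N) :=
        Measurable.of_discrete.comp (measurable_chain step s N)
      refine le_trans ?_ ih
      rw [Finset.sum_range_succ, add_assoc, lintegral_chain_succ, ← lintegral_add_left hcost]
      exact add_le_add_right (lintegral_mono fun ω => hΦ _) _
  exact ENNReal.tsum_le_of_sum_range_le fun N => le_self_add.trans (hpartial N)

end Potential

/-! ### Exactly one success among independent trials -/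

theorem exp_neg_one_le_one_sub_inv_pow {x : ℝ} (hx : 1 < x) {k : ℕ} (hk : k ≤ x - 1) :
    Real.exp (-1) ≤ (1 - x⁻¹) ^ k := by
  have hbase : 0 < 1 - x⁻¹ := sub_pos.2 (inv_lt_one_of_one_lt₀ hx)
  have hinv : 1 - (1 - x⁻¹)⁻¹ = -(x - 1)⁻¹ := by
    have : x ≠ 0 := by linarith
    have : x - 1 ≠ 0 := by linarith
    rw [show 1 - x⁻¹ = (x - 1) / x by field_simp]
    field_simp
    ring
  rw [← Real.exp_log (pow_pos hbase k), Real.log_pow, Real.exp_le_exp]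
  calc (-1 : ℝ) ≤ -(k * (x - 1)⁻¹) :=
        neg_le_neg (mul_inv_le_one_of_le₀ hk (by linarith))
    _ = k * (1 - (1 - x⁻¹)⁻¹) := by rw [hinv]; ring
    _ ≤ k * Real.log (1 - x⁻¹) := by
        gcongr
        exact Real.one_sub_inv_le_log_of_pos hbase

section OnlyOne

variable {V Ω : Type*} [Fintype V] [MeasurableSpace Ω] (ν : Measure Ω) [IsProbabilityMeasure ν]

theorem measure_pi_only {T : Set Ω} {J : Finset V} {u : V} (hu : u ∈ J) :
    (Measure.pi fun _ : V => ν) {f | f u ∈ T ∧ ∀ w ∈ J, w ≠ u → f w ∉ T} =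
      ν T * ν Tᶜ ^ (J.card - 1) := by
  classical
  have hbox : {f : V → Ω | f u ∈ T ∧ ∀ w ∈ J, w ≠ u → f w ∉ T} =
      Set.univ.pi fun w => if w = u then T else if w ∈ J then Tᶜ else Set.univ := by
    ext f
    simp only [Set.mem_ofPred_eq, Set.mem_univ_pi]
    constructor
    · rintro ⟨hfu, hfw⟩ w
      split_ifs with hw hwJ
      exacts [hw ▸ hfu, hfw w hwJ hw, trivial]
    · intro h
      refine ⟨by simpa using h u, fun w hw hwu => ?_⟩
      simpa [hw, hwu] using h w
  rw [hbox, Measure.pi_pi, ← Finset.mul_prod_erase _ _ (Finset.mem_univ u), if_pos rfl,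
    ← Finset.card_erase_of_mem hu, ← Finset.prod_const]
  congr 1
  symm
  refine Finset.prod_subset_one_on_sdiff (Finset.erase_subset_erase u (Finset.subset_univ J)) ?_ ?_
  · intro w hw
    simp only [Finset.mem_sdiff, Finset.mem_erase, Finset.mem_univ, not_and] at hw
    rw [if_neg hw.1.1, if_neg (hw.2 hw.1.1), measure_univ]
  · intro w hw
    rw [Finset.mem_erase] at hw
    rw [if_neg hw.1, if_pos hw.2]

theorem measure_pi_exists_only {T : Set Ω} (hT : MeasurableSet T) (J : Finset V) :
    (Measure.pi fun _ : V => ν) {f | ∃ u ∈ J, f u ∈ T ∧ ∀ w ∈ J, w ≠ u → f w ∉ T} =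
      J.card * (ν T * ν Tᶜ ^ (J.card - 1)) := by
  have hunion : {f : V → Ω | ∃ u ∈ J, f u ∈ T ∧ ∀ w ∈ J, w ≠ u → f w ∉ T} =
      ⋃ u ∈ J, {f | f u ∈ T ∧ ∀ w ∈ J, w ≠ u → f w ∉ T} := by
    ext f; simp only [Set.mem_iUnion, Set.mem_ofPred_eq, exists_prop]
  rw [hunion, measure_biUnion_finset, Finset.sum_congr rfl fun u hu => measure_pi_only ν hu,
    Finset.sum_const, nsmul_eq_mul]
  · intro u _ w hw huw
    rw [Function.onFun, Set.disjoint_left]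
    exact fun f ⟨_, honly⟩ ⟨hfw, _⟩ => honly w hw huw.symm hfw
  · intro u _
    measurability

theorem le_measure_mul_measure_compl_pow {T : Set Ω} (hT : MeasurableSet T) {x : ℝ} (hx : 1 < x)
    (hνT : ν T = ENNReal.ofReal x⁻¹) {k : ℕ} (hk : k ≤ x - 1) :
    ENNReal.ofReal (x⁻¹ * Real.exp (-1)) ≤ ν T * ν Tᶜ ^ k := by
  have hcompl : ν Tᶜ = ENNReal.ofReal (1 - x⁻¹) := by
    rw [prob_compl_eq_one_sub hT, hνT, ENNReal.ofReal_sub _ (by positivity), ENNReal.ofReal_one]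
  have hnonneg : 0 ≤ 1 - x⁻¹ := sub_nonneg.2 (inv_le_one_of_one_le₀ hx.le)
  rw [hνT, hcompl, ← ENNReal.ofReal_pow hnonneg, ← ENNReal.ofReal_mul (by positivity)]
  exact ENNReal.ofReal_le_ofReal (by gcongr; exact exp_neg_one_le_one_sub_inv_pow hx hk)

end OnlyOne

theorem coin_true (k : ℕ) : coin k {true} = ENNReal.ofReal (k : ℝ)⁻¹ := by
  rw [coin, bernoulliMeasure_apply _ (MeasurableSet.singleton _)]
  simp only [Set.mem_singleton_iff, ↓reduceIte, Bool.false_eq_true, unitInterval.toNNReal,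
    ENNReal.ofReal, inv_nonneg, Nat.cast_nonneg, Real.toNNReal_of_nonneg]
  rfl

theorem pi_coin_eval_true {l : ℕ} (i : Fin l) :
    (Measure.pi fun i : Fin l => coin (2 ^ (i.val + 1))) {f | f i = true} =
      ENNReal.ofReal (2 ^ (i.val + 1))⁻¹ := by
  have hcoin := coin_true (2 ^ (i.val + 1))
  rw [Nat.cast_pow, Nat.cast_two] at hcoin
  rw [← hcoin]
  exact (measurePreserving_eval (fun i : Fin l => coin (2 ^ (i.val + 1))) i).measure_preimage
    (MeasurableSet.singleton true).nullMeasurableSet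

/-! ### One round of Decay -/

theorem two_pow_clog_le_two_mul {k : ℕ} (hk : 0 < k) : 2 ^ Nat.clog 2 k ≤ 2 * k := by
  obtain rfl | hk := Nat.eq_or_lt_of_le hk
  · norm_num
  · have hpos : 0 < Nat.clog 2 k := Nat.clog_pos Nat.one_lt_two hk
    have hlt : 2 ^ (Nat.clog 2 k - 1) < k := Nat.pow_pred_clog_lt_self Nat.one_lt_two hk
    calc 2 ^ Nat.clog 2 k = 2 ^ (Nat.clog 2 k - 1) * 2 := by
          rw [← pow_succ, Nat.sub_add_cancel hpos]
      _ ≤ 2 * k := by omega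

theorem exists_two_pow_le_two_mul {k h : ℕ} (hk : 0 < k) (hh : 0 < h) (hkh : k ≤ 2 ^ h) :
    ∃ i < h, k ≤ 2 ^ (i + 1) ∧ 2 ^ (i + 1) ≤ 2 * k := by
  obtain rfl | hk := Nat.eq_or_lt_of_le hk
  · exact ⟨0, hh, by norm_num⟩
  · have hpos : 0 < Nat.clog 2 k := Nat.clog_pos Nat.one_lt_two hk
    have hle : Nat.clog 2 k ≤ h := (Nat.clog_le_iff_le_pow Nat.one_lt_two).2 hkh
    refine ⟨Nat.clog 2 k - 1, by omega, ?_⟩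
    rw [Nat.sub_add_cancel hpos]
    exact ⟨Nat.le_pow_clog Nat.one_lt_two k, two_pow_clog_le_two_mul (by omega)⟩

section Decay

variable {V : Type*} {M : Type} {l h : ℕ} {G : Digraph V} {msg : V → Option M} {v : V}

theorem decay_isSome {coins : DecayCoins V l} {i : Fin l} (hi : i.val < h) (hv : msg v = none)
    {u : V} (hu : G.Adj u v ∧ (msg u).isSome) (hui : coins u i = true)
    (honly : ∀ w, G.Adj w v ∧ (msg w).isSome → w ≠ u → ¬coins w i = true) :
    (decay G h msg coins v).isSome := by
  have hreceive : (fun u => if coins u i then msg u else none) v = none ∧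
      ∃! w, G.Adj w v ∧ (if coins w i then msg w else none).isSome := by
    refine ⟨by simp [hv], u, by simp [hu, hui], fun w ⟨hwv, hw⟩ => ?_⟩
    by_contra hwu
    by_cases hwi : coins w i = true
    · exact honly w ⟨hwv, by simpa [hwi] using hw⟩ hwu hwi
    · simp [hwi] at hw
  rw [decay, List.findSome?_isSome_iff]
  refine ⟨i, List.mem_finRange i, ?_⟩
  rw [if_pos hi, receive, dif_pos hreceive]
  exact hreceive.2.exists.choose_spec.2

variable [Fintype V]

theorem decayLaw_decay_eq_none_le (hv : msg v = none) (hne : ∃ u, G.Adj u v ∧ (msg u).isSome)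
    {I : Finset V} (hI : ∀ u, G.Adj u v → (msg u).isSome → u ∈ I) (hcard : I.card ≤ 2 ^ h)
    (hh : 0 < h) (hl : h ≤ l) :
    decayLaw V l {coins | decay G h msg coins v = none} ≤ ENNReal.ofReal 0.82 := by
  classical
  let J : Finset V := {u | G.Adj u v ∧ (msg u).isSome}
  have hmem (u : V) : u ∈ J ↔ G.Adj u v ∧ (msg u).isSome := by simp [J]
  have hJ : 0 < J.card := Finset.card_pos.2 (hne.imp fun u => (hmem u).2)
  have hJI : J.card ≤ 2 ^ h :=
    (Finset.card_le_card fun u hu => hI u ((hmem u).1 hu).1 ((hmem u).1 hu).2).trans hcard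
  obtain ⟨i, hih, hJi, hiJ⟩ := exists_two_pow_le_two_mul hJ hh hJI
  let T : Set (Fin l → Bool) := {f | f ⟨i, by omega⟩ = true}
  let heard : Set (DecayCoins V l) := {f | ∃ u ∈ J, f u ∈ T ∧ ∀ w ∈ J, w ≠ u → f w ∉ T}
  have hsub : {coins | decay G h msg coins v = none} ⊆ heardᶜ := by
    rintro coins hnone ⟨u, hu, huT, honly⟩
    have := decay_isSome (i := ⟨i, by omega⟩) hih hv ((hmem u).1 hu) huT
      fun w hw => honly w ((hmem w).2 hw)
    rw [Set.mem_ofPred_eq] at hnone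
    simp [hnone] at this
  have hprob : ENNReal.ofReal 0.18 ≤ decayLaw V l heard := by
    have hx : (1 : ℝ) < 2 ^ (i + 1) := one_lt_pow₀ one_lt_two (by omega)
    have hJx : ((J.card - 1 : ℕ) : ℝ) ≤ 2 ^ (i + 1) - 1 := by
      rw [Nat.cast_pred hJ]
      exact sub_le_sub_right (by exact_mod_cast hJi) 1
    have hhalf : (1 / 2 : ℝ) ≤ J.card * (2 ^ (i + 1))⁻¹ := by
      rw [← div_eq_mul_inv, div_le_div_iff₀ two_pos (by positivity), one_mul, mul_comm]
      exact_mod_cast hiJ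
    rw [decayLaw, measure_pi_exists_only _ .of_discrete, ← ENNReal.ofReal_natCast]
    refine le_trans ?_ (mul_le_mul_right
      (le_measure_mul_measure_compl_pow _ .of_discrete hx (pi_coin_eval_true _) hJx) _)
    rw [← ENNReal.ofReal_mul (by positivity), ← mul_assoc]
    refine ENNReal.ofReal_le_ofReal ?_
    nlinarith [Real.exp_neg_one_gt_d9]
  calc decayLaw V l {coins | decay G h msg coins v = none}
      ≤ decayLaw V l heardᶜ := measure_mono hsub
    _ = 1 - decayLaw V l heard := prob_compl_eq_one_sub .of_discrete
    _ ≤ 1 - ENNReal.ofReal 0.18 := tsub_le_tsub_left hprob 1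
    _ = ENNReal.ofReal 0.82 := by
      rw [← ENNReal.ofReal_one, ← ENNReal.ofReal_sub _ (by norm_num)]
      norm_num

end Decay

/-! ### Progress of a broadcast along a path -/

section Path

variable {V : Type*} {M : Type} {l : ℕ} {G : Digraph V} {p : ℕ → V} {d : ℕ} {m m' : V → Option M}

/-- One round of a broadcast in which all nodes take part: `m v` is the string that `v` holds at
its beginning, and `h` is the height of its round of Decay. -/
noncomputable def informRound (G : Digraph V) (h : ℕ) (m : V → Option M) (coins : DecayCoins V l) :
    V → Option M :=
  fun v => (m v).or (decay G h m coins v)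

theorem informRound_isSome (h : ℕ) (coins : DecayCoins V l) {v : V} (hv : (m v).isSome) :
    (informRound G h m coins v).isSome := by
  rw [informRound, Option.isSome_or, hv, Bool.true_or]

open Classical in
/-- The last index `j ≤ d` such that `p j` has an informed in-neighbour (`0` if there is none). -/
noncomputable def front (G : Digraph V) (p : ℕ → V) (d : ℕ) (m : V → Option M) : ℕ :=
  Nat.findGreatest (fun j => ∃ w, G.Adj w (p j) ∧ (m w).isSome) d

theorem front_le : front G p d m ≤ d := by
  classical exact Nat.findGreatest_le d

theorem le_front {j : ℕ} (hj : j ≤ d) {w : V} (hadj : G.Adj w (p j)) (hw : (m w).isSome) :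
    j ≤ front G p d m := by
  classical exact Nat.le_findGreatest hj ⟨w, hadj, hw⟩

theorem front_mono (hm : ∀ w, (m w).isSome → (m' w).isSome) : front G p d m ≤ front G p d m' := by
  classical exact Nat.findGreatest_mono_left (fun _ ⟨w, hadj, hw⟩ => ⟨w, hadj, hm w hw⟩) d

theorem exists_adj_front (hd : 0 < d) (hp : G.Adj (p 0) (p 1)) (h0 : (m (p 0)).isSome) :
    ∃ w, G.Adj w (p (front G p d m)) ∧ (m w).isSome := by
  classical
  exact Nat.findGreatest_spec (P := fun j => ∃ w, G.Adj w (p j) ∧ (m w).isSome) hd ⟨p 0, hp, h0⟩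

theorem eq_none_front (hp : ∀ i < d, G.Adj (p i) (p (i + 1))) (hd : m (p d) = none) :
    m (p (front G p d m)) = none := by
  by_contra hne
  obtain hlt | heq := (front_le (G := G) (p := p) (d := d) (m := m)).lt_or_eq
  · have := le_front (d := d) hlt (hp _ hlt) (Option.isSome_iff_ne_none.2 hne)
    omega
  · exact hne (by rw [heq, hd])

theorem front_lt_front (hp : ∀ i < d, G.Adj (p i) (p (i + 1))) (hd : m' (p d) = none)
    (hm' : (m' (p (front G p d m))).isSome) : front G p d m < front G p d m' := by
  have hlt : front G p d m < d := by
    refine front_le.lt_of_ne fun h => ?_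
    rw [h, hd] at hm'
    exact Bool.noConfusion hm'
  exact le_front hlt (hp _ hlt) hm'

open Classical in
/-- The nodes whose last out-neighbour among `p 0, …, p d` is `p j`. When the front is at `j`, all
informed in-neighbours of `p j` are of this kind. -/
noncomputable def lastInNeighbors [Fintype V] (G : Digraph V) (p : ℕ → V) (d j : ℕ) : Finset V :=
  {w | G.Adj w (p j) ∧ ∀ i, j < i → i ≤ d → ¬G.Adj w (p i)}

theorem mem_lastInNeighbors [Fintype V] {j : ℕ} {w : V} :
    w ∈ lastInNeighbors G p d j ↔ G.Adj w (p j) ∧ ∀ i, j < i → i ≤ d → ¬G.Adj w (p i) := by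
  simp only [lastInNeighbors, Finset.mem_filter, Finset.mem_univ, true_and]

/-- The height from which on Decay works for up to `k` participants. -/
def neededHeight (k : ℕ) : ℕ := max 1 (Nat.clog 2 k)

theorem decayLaw_decay_front_eq_none_le [Fintype V] {h : ℕ} (hp : ∀ i < d, G.Adj (p i) (p (i + 1)))
    (hd : 0 < d) (h0 : (m (p 0)).isSome) (hmd : m (p d) = none)
    (hh : neededHeight (lastInNeighbors G p d (front G p d m)).card ≤ h) (hl : h ≤ l) :
    decayLaw V l {coins | decay G h m coins (p (front G p d m)) = none} ≤ ENNReal.ofReal 0.82 := by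
  refine decayLaw_decay_eq_none_le (eq_none_front hp hmd) (exists_adj_front hd (hp 0 hd) h0)
    (fun u hadj hu => mem_lastInNeighbors.2 ⟨hadj, fun i hi hid hadj' => ?_⟩)
    ((Nat.clog_le_iff_le_pow Nat.one_lt_two).1 (le_of_max_le_right hh)) (le_of_max_le_left hh) hl
  exact (le_front hid hadj' hu).not_gt hi

end Path

theorem exp_mul_le {t : ℝ} (h0 : 0 ≤ t) (h1 : t ≤ 1) (a : ℝ) :
    Real.exp (t * a) ≤ 1 - t + t * Real.exp a := by
  simpa using convexOn_exp.2 (Set.mem_univ 0) (Set.mem_univ a) (sub_nonneg.2 h1) h0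
    (sub_add_cancel 1 t)

theorem exp_neg_seven_mul_add_exp_le_one {x : ℝ} (h0 : 0 ≤ x) (h1 : x ≤ 1 / 10) :
    0.18 * Real.exp (-(7 * x)) + 0.82 * Real.exp x ≤ 1 := by
  have hpos : Real.exp (1 / 10) ≤ 1.1053 := by
    refine le_of_pow_le_pow_left₀ (n := 10) (by norm_num) (by norm_num) ?_
    rw [← Real.exp_nat_mul, show ((10 : ℕ) : ℝ) * (1 / 10) = 1 by norm_num]
    norm_num
    linarith [Real.exp_one_lt_d9]
  have hneg : Real.exp (-(7 / 10)) ≤ 0.52 := by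
    refine le_of_pow_le_pow_left₀ (n := 10) (by norm_num) (by norm_num) ?_
    rw [← Real.exp_nat_mul, show ((10 : ℕ) : ℝ) * (-(7 / 10)) = (7 : ℕ) * (-1) by norm_num,
      Real.exp_nat_mul]
    calc Real.exp (-1) ^ 7 ≤ (0.37 : ℝ) ^ 7 :=
          pow_le_pow_left₀ (Real.exp_pos _).le (by linarith [Real.exp_neg_one_lt_d9]) 7
      _ ≤ _ := by norm_num
  have hchord := exp_mul_le (t := 10 * x) (by linarith) (by linarith)
  have hchord_pos := hchord (1 / 10)
  have hchord_neg := hchord (-(7 / 10))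
  rw [show 10 * x * (1 / 10) = x by ring] at hchord_pos
  rw [show 10 * x * (-(7 / 10)) = -(7 * x) by ring] at hchord_neg
  nlinarith

theorem one_add_mul_exp_sub_one_le_exp {x : ℝ} (h0 : 0 ≤ x) (h1 : x ≤ 1 / 10) :
    1 + 0.82 * (Real.exp (8 * x) - 1) ≤ Real.exp (7 * x) :=
  calc 1 + 0.82 * (Real.exp (8 * x) - 1)
      = Real.exp (7 * x) * (0.18 * Real.exp (-(7 * x)) + 0.82 * Real.exp x) := by
        rw [Real.exp_neg, show 8 * x = 7 * x + x by ring, Real.exp_add]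
        field_simp
        ring
    _ ≤ Real.exp (7 * x) :=
        mul_le_of_le_one_right (Real.exp_pos _).le (exp_neg_seven_mul_add_exp_le_one h0 h1)

theorem lintegral_ite_le {X : Type*} [MeasurableSpace X] {μ : Measure X} [IsProbabilityMeasure μ]
    {P : X → Prop} [DecidablePred P] (hP : MeasurableSet {x | P x}) {a b ε : ℝ} (hb : 0 ≤ b)
    (hab : b ≤ a) (hε : 0 ≤ ε) (hμ : μ {x | P x} ≤ ENNReal.ofReal ε) :
    ∫⁻ x, ENNReal.ofReal (if P x then a else b) ∂μ ≤ ENNReal.ofReal (b + ε * (a - b)) := by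
  have hsub : 0 ≤ a - b := sub_nonneg.2 hab
  calc ∫⁻ x, ENNReal.ofReal (if P x then a else b) ∂μ
      = ∫⁻ x, ENNReal.ofReal b + {x | P x}.indicator (fun _ => ENNReal.ofReal (a - b)) x ∂μ := by
        refine lintegral_congr fun x => ?_
        rw [Set.indicator_apply]
        simp only [Set.mem_ofPred_eq]
        split_ifs
        · rw [← ENNReal.ofReal_add hb hsub, add_sub_cancel]
        · rw [add_zero]
    _ = ENNReal.ofReal b + ENNReal.ofReal (a - b) * μ {x | P x} := by
        rw [lintegral_add_left measurable_const, lintegral_indicator_const hP, lintegral_const,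
          measure_univ, mul_one]
    _ ≤ ENNReal.ofReal b + ENNReal.ofReal (a - b) * ENNReal.ofReal ε := by gcongr
    _ = ENNReal.ofReal (b + ε * (a - b)) := by
        rw [← ENNReal.ofReal_mul hsub, ← ENNReal.ofReal_add hb (mul_nonneg hsub hε), mul_comm ε]

/-- Data for the analysis of a broadcast whose round `q` has height `h q` along a path whose node
`j` can be informed in a round of height at least `need j`: among any `gap j` successive rounds,
one has this height. The number `θ` is the rate at which the potential grows with time. -/
structure Schedule (h need : ℕ → ℕ) (θ : ℝ) where
  /-- A number of successive rounds among which one is high enough for node `j`. -/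
  gap : ℕ → ℕ
  exists_height : ∀ j q, ∃ r < gap j, need j ≤ h (q + r)
  rate_nonneg : 0 ≤ θ
  rate_mul_gap : ∀ j, θ * gap j ≤ 1 / 10

namespace Schedule

variable {h need : ℕ → ℕ} {θ : ℝ}

theorem exists_wait (S : Schedule h need θ) (j q : ℕ) : ∃ r, need j ≤ h (q + r) :=
  (S.exists_height j q).imp fun _ => And.right

variable (S : Schedule h need θ) {q j d : ℕ}

/-- The number of rounds from round `q` on until the next one that is high enough for node `j`. -/
def wait (j q : ℕ) : ℕ := Nat.find (S.exists_wait j q)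

theorem wait_lt (j q : ℕ) : S.wait j q < S.gap j :=
  let ⟨_, hr, hh⟩ := S.exists_height j q
  (Nat.find_min' (S.exists_wait j q) hh).trans_lt hr

theorem need_le_of_wait_eq_zero (hw : S.wait j q = 0) : need j ≤ h q :=
  (Nat.find_eq_zero (S.exists_wait j q)).1 hw

theorem wait_succ_lt (hw : S.wait j q ≠ 0) : S.wait j (q + 1) + 1 ≤ S.wait j q := by
  have hspec : need j ≤ h (q + S.wait j q) := Nat.find_spec (S.exists_wait j q)
  have hle : S.wait j (q + 1) ≤ S.wait j q - 1 :=
    Nat.find_min' _ (by rwa [show q + 1 + (S.wait j q - 1) = q + S.wait j q by omega])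
  omega

/-- The total gap of the nodes after `j` up to `d`. -/
def rest (d j : ℕ) : ℕ := ∑ i ∈ Finset.Ioc j d, S.gap i

theorem gap_add_rest_le {j' : ℕ} (hj : j < j') (hd : j' ≤ d) :
    S.gap j' + S.rest d j' ≤ S.rest d j := by
  rw [rest, ← Finset.sum_insert Finset.left_notMem_Ioc, Finset.Ioc_insert_left hd]
  exact Finset.sum_le_sum_of_subset ((Finset.Icc_subset_Ioc_iff hd).2 ⟨hj, le_rfl⟩)

/-- The potential before round `q` if the front is at `j`. -/
noncomputable def weight (d q j : ℕ) : ℝ :=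
  Real.exp (θ * (q + 7 * S.gap j + S.wait j q + 8 * S.rest d j))

/-- A bound for the potential after round `q` if this round has moved the front beyond `j`. -/
noncomputable def nextWeight (d q j : ℕ) : ℝ :=
  Real.exp (θ * (q + 8 * S.rest d j))

theorem weight_succ_le_nextWeight {j' : ℕ} (hj : j < j') (hd : j' ≤ d) :
    S.weight d (q + 1) j' ≤ S.nextWeight d q j := by
  refine Real.exp_le_exp.2 (mul_le_mul_of_nonneg_left ?_ S.rate_nonneg)
  have hgap := S.gap_add_rest_le hj hd
  have hwait := S.wait_lt j' (q + 1)
  norm_cast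
  omega

theorem max_nextWeight_weight_succ_le (hw : S.wait j q ≠ 0) :
    max (S.nextWeight d q j) (S.weight d (q + 1) j) ≤ S.weight d q j := by
  have hwait := S.wait_succ_lt hw
  refine max_le ?_ ?_ <;>
  · refine Real.exp_le_exp.2 (mul_le_mul_of_nonneg_left ?_ S.rate_nonneg)
    norm_cast
    omega

theorem max_nextWeight_weight_succ_le_mul_exp :
    max (S.nextWeight d q j) (S.weight d (q + 1) j) ≤
      S.nextWeight d q j * Real.exp (8 * (θ * S.gap j)) := by
  have hwait := S.wait_lt j (q + 1)
  rw [nextWeight, weight, ← Real.exp_add, mul_left_comm, ← mul_add]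
  refine max_le ?_ ?_ <;>
  · refine Real.exp_le_exp.2 (mul_le_mul_of_nonneg_left ?_ S.rate_nonneg)
    norm_cast
    omega

theorem nextWeight_mul_le_weight :
    S.nextWeight d q j * (1 + 0.82 * (Real.exp (8 * (θ * S.gap j)) - 1)) ≤ S.weight d q j :=
  calc S.nextWeight d q j * (1 + 0.82 * (Real.exp (8 * (θ * S.gap j)) - 1))
      ≤ S.nextWeight d q j * Real.exp (7 * (θ * S.gap j)) :=
        mul_le_mul_of_nonneg_left (one_add_mul_exp_sub_one_le_exp
          (mul_nonneg S.rate_nonneg (Nat.cast_nonneg _)) (S.rate_mul_gap j)) (Real.exp_pos _).le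
    _ ≤ S.weight d q j := by
        rw [nextWeight, weight, ← Real.exp_add, mul_left_comm, ← mul_add]
        refine Real.exp_le_exp.2 (mul_le_mul_of_nonneg_left ?_ S.rate_nonneg)
        norm_cast
        omega

theorem weight_zero_le (hj : 0 < j) (hd : j ≤ d) :
    S.weight d 0 j ≤ Real.exp (θ * (8 * S.rest d 0)) := by
  refine Real.exp_le_exp.2 (mul_le_mul_of_nonneg_left ?_ S.rate_nonneg)
  have hgap := S.gap_add_rest_le hj hd
  have hwait := S.wait_lt j 0
  norm_cast
  omega

theorem exp_le_weight : Real.exp (θ * q) ≤ S.weight d q j := by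
  refine Real.exp_le_exp.2 (mul_le_mul_of_nonneg_left ?_ S.rate_nonneg)
  norm_cast
  omega

end Schedule

section PathSchedule

variable {V : Type*} [Fintype V] {M : Type} {l : ℕ} {G : Digraph V} {h : ℕ → ℕ} {p : ℕ → V} {d : ℕ}
  {θ : ℝ}

/-- A `Schedule` for the path `p 0, …, p d`, at whose node `j` at most the nodes in
`lastInNeighbors G p d j` compete when the front is there. -/
abbrev PathSchedule (G : Digraph V) (h : ℕ → ℕ) (p : ℕ → V) (d : ℕ) (θ : ℝ) : Type :=
  Schedule h (fun j => neededHeight (lastInNeighbors G p d j).card) θ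

variable (S : PathSchedule G h p d θ) {q : ℕ} {m : V → Option M}

open Classical in
/-- The potential of a state of the broadcast before round `q`. It is infinite if the first node of
the path holds no string, so that it is a supermartingale from every state. -/
noncomputable def potential (q : ℕ) (m : V → Option M) : ℝ≥0∞ :=
  if m (p 0) = none then ⊤
  else if m (p d) = none then ENNReal.ofReal (S.weight d q (front G p d m)) else 0

variable (hp : ∀ i < d, G.Adj (p i) (p (i + 1)))

include hp

open Classical in
theorem potential_informRound_le (h0 : m (p 0) ≠ none) (coins : DecayCoins V l) :
    potential S (q + 1) (informRound G (h q) m coins) ≤ ENNReal.ofReal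
      (if decay G (h q) m coins (p (front G p d m)) = none then
        max (S.nextWeight d q (front G p d m)) (S.weight d (q + 1) (front G p d m))
      else S.nextWeight d q (front G p d m)) := by
  set m' := informRound G (h q) m coins with hm'
  have hinformed (v : V) : (m v).isSome → (m' v).isSome := informRound_isSome (h q) coins
  have h0' : m' (p 0) ≠ none :=
    Option.isSome_iff_ne_none.1 (hinformed _ (Option.isSome_iff_ne_none.2 h0))
  rw [potential, if_neg h0']
  split_ifs with hd hdecay hdecay
  · obtain hlt | heq := (front_mono (G := G) (p := p) (d := d) hinformed).lt_or_eq
    · exact ENNReal.ofReal_le_ofReal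
        ((S.weight_succ_le_nextWeight hlt front_le).trans (le_max_left _ _))
    · exact heq ▸ ENNReal.ofReal_le_ofReal (le_max_right _ _)
  · refine ENNReal.ofReal_le_ofReal
      (S.weight_succ_le_nextWeight (front_lt_front hp hd ?_) front_le)
    rw [hm', informRound, Option.isSome_or, Option.isSome_iff_ne_none.2 hdecay, Bool.or_true]
  all_goals exact zero_le

theorem lintegral_potential_le_weight (hl : ∀ q, h q ≤ l) (h0 : m (p 0) ≠ none)
    (hd : m (p d) = none) :
    ∫⁻ coins, potential S (q + 1) (informRound G (h q) m coins) ∂(decayLaw V l) ≤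
      ENNReal.ofReal (S.weight d q (front G p d m)) := by
  classical
  have hle := lintegral_mono (μ := decayLaw V l) fun coins =>
    potential_informRound_le S hp (q := q) h0 coins
  set j := front G p d m
  by_cases hw : S.wait j q = 0
  · have hdpos : 0 < d := Nat.pos_of_ne_zero fun h => h0 (h ▸ hd)
    have hfail := decayLaw_decay_front_eq_none_le hp hdpos (Option.isSome_iff_ne_none.2 h0) hd
      (S.need_le_of_wait_eq_zero hw) (hl q)
    refine (hle.trans (lintegral_ite_le .of_discrete (Real.exp_pos _).le (le_max_left _ _)
      (by norm_num) hfail)).trans (ENNReal.ofReal_le_ofReal ?_)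
    calc S.nextWeight d q j +
          0.82 * (max (S.nextWeight d q j) (S.weight d (q + 1) j) - S.nextWeight d q j)
        ≤ S.nextWeight d q j + 0.82 *
          (S.nextWeight d q j * Real.exp (8 * (θ * S.gap j)) - S.nextWeight d q j) := by
          gcongr
          exact S.max_nextWeight_weight_succ_le_mul_exp
      _ = S.nextWeight d q j * (1 + 0.82 * (Real.exp (8 * (θ * S.gap j)) - 1)) := by ring
      _ ≤ S.weight d q j := S.nextWeight_mul_le_weight
  · have hmax := S.max_nextWeight_weight_succ_le (d := d) hw
    calc _ ≤ _ := hle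
      _ ≤ ∫⁻ _, ENNReal.ofReal (S.weight d q j) ∂(decayLaw V l) := by
          refine lintegral_mono fun coins => ENNReal.ofReal_le_ofReal ?_
          split_ifs
          · exact hmax
          · exact (le_max_left _ _).trans hmax
      _ = _ := by simp

theorem lintegral_potential_le (hl : ∀ q, h q ≤ l) :
    ∫⁻ coins, potential S (q + 1) (informRound G (h q) m coins) ∂(decayLaw V l) ≤
      potential S q m := by
  rw [potential]
  split_ifs with h0 hd
  · exact le_top
  · exact lintegral_potential_le_weight S hp hl h0 hd
  · have hzero (coins : DecayCoins V l) :
        potential S (q + 1) (informRound G (h q) m coins) = 0 := by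
      have hinformed {v : V} (hv : m v ≠ none) : informRound G (h q) m coins v ≠ none :=
        Option.isSome_iff_ne_none.1 (informRound_isSome _ _ (Option.isSome_iff_ne_none.2 hv))
      rw [potential, if_neg (hinformed h0), if_neg (hinformed hd)]
    simp [hzero]

theorem potential_zero_le (h0 : m (p 0) ≠ none) :
    potential S 0 m ≤ ENNReal.ofReal (Real.exp (θ * (8 * S.rest d 0))) := by
  rw [potential, if_neg h0]
  split_ifs with hd
  · have hdpos : 0 < d := Nat.pos_of_ne_zero fun h => h0 (h ▸ hd)
    exact ENNReal.ofReal_le_ofReal (S.weight_zero_le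
      (le_front hdpos (hp 0 hdpos) (Option.isSome_iff_ne_none.2 h0)) front_le)
  · exact zero_le

omit hp in
theorem ofReal_exp_le_potential (hd : m (p d) = none) :
    ENNReal.ofReal (Real.exp (θ * q)) ≤ potential S q m := by
  rw [potential]
  split_ifs
  · exact le_top
  · exact ENNReal.ofReal_le_ofReal S.exp_le_weight

theorem measure_multiBroadcast_eq_none_le (hl : ∀ q, h q ≤ l) {f : V → Option M}
    (h0 : f (p 0) ≠ none) (Q : ℕ) :
    (Measure.pi fun _ : Fin Q => decayLaw V l)
        {coins | multiBroadcast G h (fun _ => true) f coins (p d) = none} ≤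
      ENNReal.ofReal (Real.exp (θ * (8 * S.rest d 0 - Q))) := by
  have hfold : ∫⁻ coins : Fin Q → DecayCoins V l,
        potential S Q (multiBroadcast G h (fun _ => true) f coins)
        ∂(Measure.pi fun _ => decayLaw V l) ≤ potential S 0 f :=
    lintegral_foldl_finRange_le (decayLaw V l) (fun q m coins => informRound G (h q) m coins)
      (potential S) (fun q m => lintegral_potential_le S hp hl) f
  have hmarkov := (mul_meas_ge_le_lintegral (μ := Measure.pi fun _ : Fin Q => decayLaw V l)
    .of_discrete (ENNReal.ofReal (Real.exp (θ * Q)))).trans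
      (hfold.trans (potential_zero_le S hp h0))
  rw [mul_sub, Real.exp_sub, ENNReal.ofReal_div_of_pos (Real.exp_pos _),
    ENNReal.le_div_iff_mul_le (by simp [Real.exp_pos]) (by simp), mul_comm]
  refine le_trans ?_ hmarkov
  gcongr with coins
  exact ofReal_exp_le_potential S

end PathSchedule

/-! ### The broadcast schedule -/

section Parameters

theorem logSize_pos {n : ℕ} (hn : 1 < n) : 0 < logSize n := Nat.clog_pos Nat.one_lt_two hn

theorem le_two_pow_logSize (n : ℕ) : n ≤ 2 ^ logSize n := Nat.le_pow_clog Nat.one_lt_two n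

variable {n D : ℕ}

theorem lt_mul_two_pow_logRatio (hD : 0 < D) : n < D * 2 ^ logRatio n D := by
  rw [mul_comm, ← Nat.div_lt_iff_lt_mul hD]
  exact Nat.lt_pow_succ_log_self Nat.one_lt_two (n / D)

theorem fullPeriod_pos : 0 < fullPeriod n D := Nat.succ_pos _

theorem roundHeight_le (q : ℕ) : roundHeight n D q ≤ logSize n := by
  unfold roundHeight
  split_ifs
  exacts [le_rfl, min_le_left _ _]

/-- A number of successive rounds of a broadcast among which one has height at least `t`. -/
def heightGap (n D t : ℕ) : ℕ := min (fullPeriod n D) (2 ^ (t - logRatio n D))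

theorem exists_lt_dvd_add {a : ℕ} (ha : 0 < a) (q : ℕ) : ∃ r < a, a ∣ q + r := by
  refine ⟨(a - q % a) % a, Nat.mod_lt _ ha, Nat.modEq_zero_iff_dvd.1 ?_⟩
  calc q + (a - q % a) % a ≡ q % a + (a - q % a) [MOD a] :=
        (Nat.mod_modEq q a).symm.add (Nat.mod_modEq _ a)
    _ = a := Nat.add_sub_cancel' (Nat.mod_lt q ha).le
    _ ≡ 0 [MOD a] := Nat.modEq_zero_iff_dvd.2 dvd_rfl

theorem exists_le_roundHeight {t : ℕ} (ht : t ≤ logSize n) (q : ℕ) :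
    ∃ r < heightGap n D t, t ≤ roundHeight n D (q + r) := by
  rcases le_total (fullPeriod n D) (2 ^ (t - logRatio n D)) with h | h
  · obtain ⟨r, hr, hdvd⟩ := exists_lt_dvd_add (fullPeriod_pos (n := n) (D := D)) q
    rw [heightGap, min_eq_left h]
    exact ⟨r, hr, by rwa [roundHeight, if_pos (Nat.mod_eq_zero_of_dvd hdvd)]⟩
  · obtain ⟨r, hr, hdvd⟩ := exists_lt_dvd_add (Nat.two_pow_pos (t - logRatio n D)) (q + 1)
    rw [heightGap, min_eq_right h]
    refine ⟨r, hr, ?_⟩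
    rw [roundHeight]
    split_ifs
    · exact ht
    · have hval := (padicValNat_dvd_iff_le (p := 2) (by omega)).1 hdvd
      rw [add_right_comm] at hval
      exact le_min ht (by omega)

theorem mul_heightGap_neededHeight_le (hD : 0 < D) (k : ℕ) :
    n * heightGap n D (neededHeight k) ≤ n + 2 * D * k := by
  refine (Nat.mul_le_mul_left n (min_le_right _ _)).trans ?_
  rcases le_or_gt (neededHeight k) (logRatio n D) with hle | hlt
  · rw [Nat.sub_eq_zero_of_le hle, pow_zero, mul_one]
    exact Nat.le_add_right _ _
  · have hclog : neededHeight k = Nat.clog 2 k := max_eq_right <| by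
      by_contra hone
      rw [neededHeight, max_eq_left (by omega), logRatio] at hlt
      omega
    rw [hclog] at hlt ⊢
    have hk : 0 < k := Nat.pos_of_ne_zero fun hk => by simp [hk] at hlt
    calc n * 2 ^ (Nat.clog 2 k - logRatio n D)
        ≤ D * 2 ^ logRatio n D * 2 ^ (Nat.clog 2 k - logRatio n D) :=
          Nat.mul_le_mul_right _ (lt_mul_two_pow_logRatio hD).le
      _ = D * 2 ^ Nat.clog 2 k := by rw [mul_assoc, ← pow_add, Nat.add_sub_cancel' hlt.le]
      _ ≤ D * (2 * k) := Nat.mul_le_mul_left _ (two_pow_clog_le_two_mul hk)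
      _ = 2 * D * k := by ring
      _ ≤ n + 2 * D * k := Nat.le_add_left _ _

end Parameters

section Network

variable {V : Type*} {G : Digraph V}

theorem exists_path (hG : StronglyConnected G) (u v : V) :
    ∃ (k : ℕ) (p : ℕ → V), p 0 = u ∧ p k = v ∧ ∀ i < k, G.Adj (p i) (p (i + 1)) := by
  induction hG u v with
  | refl => exact ⟨0, fun _ => u, rfl, rfl, fun i hi => absurd hi (Nat.not_lt_zero i)⟩
  | @tail b w _ hbw ih =>
    obtain ⟨k, p, h0, hk, hp⟩ := ih
    refine ⟨k + 1, fun i => if i ≤ k then p i else w, by simp [h0], by simp, fun i hi => ?_⟩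
    rcases Nat.lt_succ_iff_lt_or_eq.1 hi with hlt | rfl
    · simpa [hlt.le, Nat.succ_le_of_lt hlt] using hp i hlt
    · simpa [hk] using hbw

variable [Fintype V]

theorem exists_path_le_eccentricity (hG : StronglyConnected G) (u v : V) :
    ∃ d ≤ eccentricity G, ∃ p : ℕ → V, p 0 = u ∧ p d = v ∧ ∀ i < d, G.Adj (p i) (p (i + 1)) :=
  ⟨hopDist G u v,
    (Finset.le_sup (f := hopDist G u) (Finset.mem_univ v)).trans
      (Finset.le_sup (f := fun u => Finset.univ.sup (hopDist G u)) (Finset.mem_univ u)),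
    Nat.sInf_mem (exists_path hG u v)⟩

theorem sum_card_lastInNeighbors_le (G : Digraph V) (p : ℕ → V) (d : ℕ) :
    ∑ j ∈ Finset.Ioc 0 d, (lastInNeighbors G p d j).card ≤ Fintype.card V := by
  classical
  have hdisj {i j : ℕ} (hj : j ≤ d) (hij : i < j) :
      Disjoint (lastInNeighbors G p d i) (lastInNeighbors G p d j) :=
    Finset.disjoint_left.2 fun w hwi hwj =>
      (mem_lastInNeighbors.1 hwi).2 j hij hj (mem_lastInNeighbors.1 hwj).1
  rw [← Finset.card_biUnion]
  · exact Finset.card_le_univ _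
  · intro i hi j hj hij
    rw [Finset.mem_coe, Finset.mem_Ioc] at hi hj
    rcases hij.lt_or_gt with h | h
    exacts [hdisj hj.2 h, (hdisj hi.2 h).symm]

theorem sum_heightGap_le [Nonempty V] (G : Digraph V) (p : ℕ → V) {d D : ℕ} (hd : d ≤ D) :
    ∑ j ∈ Finset.Ioc 0 d,
      heightGap (Fintype.card V) D (neededHeight (lastInNeighbors G p d j).card) ≤ 3 * D := by
  rcases Nat.eq_zero_or_pos D with rfl | hD
  · simp [Nat.le_zero.1 hd]
  refine Nat.le_of_mul_le_mul_left (c := Fintype.card V) ?_ Fintype.card_pos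
  rw [Finset.mul_sum]
  calc _ ≤ ∑ j ∈ Finset.Ioc 0 d,
          (Fintype.card V + 2 * D * (lastInNeighbors G p d j).card) :=
        Finset.sum_le_sum fun j _ => mul_heightGap_neededHeight_le hD _
    _ = d * Fintype.card V + 2 * D * ∑ j ∈ Finset.Ioc 0 d, (lastInNeighbors G p d j).card := by
        rw [Finset.sum_add_distrib, Finset.mul_sum]
        simp
    _ ≤ D * Fintype.card V + 2 * D * Fintype.card V := by
        gcongr
        exact sum_card_lastInNeighbors_le G p d
    _ = Fintype.card V * (3 * D) := by ring

variable [Nontrivial V]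

/-- The heights of the rounds of a broadcast in a network of eccentricity `D` as a `Schedule` for a
path of length `d`. -/
noncomputable def pathSchedule (G : Digraph V) (p : ℕ → V) (d D : ℕ) :
    PathSchedule G (roundHeight (Fintype.card V) D) p d
      (1 / (10 * fullPeriod (Fintype.card V) D)) where
  gap j := heightGap (Fintype.card V) D (neededHeight (lastInNeighbors G p d j).card)
  exists_height j := exists_le_roundHeight <|
    max_le (logSize_pos Fintype.one_lt_card) (Nat.clog_mono_right 2 (Finset.card_le_univ _))
  rate_nonneg := by positivity
  rate_mul_gap j := by
    have hperiod : (0 : ℝ) < fullPeriod (Fintype.card V) D := by exact_mod_cast fullPeriod_pos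
    rw [div_mul_eq_mul_div, one_mul, div_le_div_iff₀ (by positivity) (by norm_num), one_mul,
      mul_comm]
    gcongr
    exact min_le_left _ _

theorem measure_multiBroadcast_path_eq_none_le {M : Type} {p : ℕ → V} {d D K : ℕ}
    (hp : ∀ i < d, G.Adj (p i) (p (i + 1))) (hd : d ≤ D) (hK : 24 ≤ K) {f : V → Option M}
    (hf : f (p 0) ≠ none) :
    (Measure.pi fun _ : Fin (numRounds K (Fintype.card V) D) =>
        decayLaw V (logSize (Fintype.card V))) {coins |
          multiBroadcast G (roundHeight (Fintype.card V) D) (fun _ => true) f coins (p d) = none} ≤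
      ENNReal.ofReal (Real.exp (-(K * logSize (Fintype.card V) / 10))) := by
  refine (measure_multiBroadcast_eq_none_le (pathSchedule G p d D) hp roundHeight_le hf _).trans
    (ENNReal.ofReal_le_ofReal (Real.exp_le_exp.2 ?_))
  have hrest : ((pathSchedule G p d D).rest d 0 : ℝ) ≤ 3 * D := by
    exact_mod_cast sum_heightGap_le G p hd
  have hperiod : (0 : ℝ) < fullPeriod (Fintype.card V) D := by exact_mod_cast fullPeriod_pos
  have hKD : (24 : ℝ) * D ≤ K * D := by gcongr; exact_mod_cast hK
  rw [numRounds, div_mul_eq_mul_div, one_mul, div_le_iff₀ (by positivity)]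
  push_cast
  linarith

theorem measure_exists_multiBroadcast_eq_none_le {M : Type} (hG : StronglyConnected G) {K : ℕ}
    (hK : 24 ≤ K) {f : V → Option M} (hf : ∃ v, f v ≠ none) :
    (Measure.pi fun _ : Fin (numRounds K (Fintype.card V) (eccentricity G)) =>
        decayLaw V (logSize (Fintype.card V))) {coins | ∃ v,
          multiBroadcast G (roundHeight (Fintype.card V) (eccentricity G)) (fun _ => true) f coins
            v = none} ≤
      ENNReal.ofReal
        (Fintype.card V * Real.exp (-(K * logSize (Fintype.card V) / 10))) := by
  obtain ⟨s, hs⟩ := hf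
  rw [Set.ofPred_exists, ENNReal.ofReal_mul (by positivity), ENNReal.ofReal_natCast,
    ← nsmul_eq_mul, ← Finset.card_univ, ← Finset.sum_const]
  refine (measure_iUnion_fintype_le _ _).trans (Finset.sum_le_sum fun v _ => ?_)
  obtain ⟨d, hd, p, rfl, rfl, hp⟩ := exists_path_le_eccentricity hG s v
  exact measure_multiBroadcast_path_eq_none_le hp hd hK hs

end Network

/-- The constant `K` in the number of rounds of a broadcast for which a broadcast fails with
probability at most `n ^ (-3 * c) / 128`. -/
def roundFactor (c : ℕ) : ℕ := 10 * (3 * c + 8)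

theorem pow_mul_le_two_pow_mul_logSize (c : ℕ) {n : ℕ} (hn : 1 < n) :
    n ^ (3 * c + 1) * 2 ^ 7 ≤ 2 ^ ((3 * c + 8) * logSize n) :=
  calc n ^ (3 * c + 1) * 2 ^ 7 ≤ (2 ^ logSize n) ^ (3 * c + 1) * (2 ^ logSize n) ^ 7 := by
        gcongr
        · exact le_two_pow_logSize n
        · exact Nat.le_self_pow (logSize_pos hn).ne' 2
    _ = 2 ^ ((3 * c + 8) * logSize n) := by
        rw [← pow_add, ← pow_mul]
        ring_nf

theorem mul_exp_roundFactor_le (c : ℕ) {n : ℕ} (hn : 1 < n) :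
    n * Real.exp (-(roundFactor c * logSize n / 10)) ≤ ((n : ℝ) ^ (3 * c))⁻¹ / 128 := by
  have hexp : (n : ℝ) ^ (3 * c) * n * 128 ≤ Real.exp (roundFactor c * logSize n / 10) :=
    calc (n : ℝ) ^ (3 * c) * n * 128 ≤ 2 ^ ((3 * c + 8) * logSize n) := by
          rw [← pow_succ]
          exact_mod_cast pow_mul_le_two_pow_mul_logSize c hn
      _ ≤ Real.exp 1 ^ ((3 * c + 8) * logSize n) := by
          gcongr
          linarith [Real.exp_one_gt_d9]
      _ = Real.exp (roundFactor c * logSize n / 10) := by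
          rw [← Real.exp_nat_mul, roundFactor]
          push_cast
          ring_nf
  rw [Real.exp_neg, ← div_eq_mul_inv, ← one_div, div_div,
    div_le_div_iff₀ (Real.exp_pos _) (by positivity)]
  linarith

/-! ### Detection of conflicts -/

section Origin

variable {V : Type*} {M : Type} {l Q h : ℕ} {G : Digraph V} {part : V → Bool} {f : V → Option M}
  {coins : Fin Q → DecayCoins V l} {v : V} {y : M}

theorem exists_of_receive_eq_some (hy : receive G f v = some y) : ∃ u, f u = some y := by
  unfold receive at hy
  split_ifs at hy
  exact ⟨_, hy⟩

theorem exists_of_decay_eq_some {coins : DecayCoins V l} (hy : decay G h f coins v = some y) :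
    ∃ u, f u = some y := by
  obtain ⟨i, -, hi⟩ := List.exists_of_findSome?_eq_some hy
  split_ifs at hi
  obtain ⟨u, hu⟩ := exists_of_receive_eq_some hi
  split_ifs at hu
  exact ⟨u, hu⟩

variable {h : ℕ → ℕ}

theorem exists_of_multiBroadcast_eq_some (hy : multiBroadcast G h part f coins v = some y) :
    ∃ u, f u = some y := by
  suffices ∀ v y, multiBroadcast G h part f coins v = some y → ∃ u, f u = some y from this v y hy
  refine List.foldlRecOn (motive := fun m : V → Option M => ∀ v y, m v = some y → ∃ u, f u = some y)
    _ _ (fun v _ hy => ⟨v, hy⟩) fun m ih q _ v y hy => ?_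
  rcases Option.or_eq_some_iff.1 hy with hy | ⟨-, hy⟩
  · exact ih v y hy
  · split_ifs at hy
    obtain ⟨u, hu⟩ := exists_of_decay_eq_some hy
    exact ih u y hu

theorem multiBroadcast_of_eq_some (hy : f v = some y) :
    multiBroadcast G h part f coins v = some y :=
  List.foldlRecOn (motive := fun m : V → Option M => m v = some y) _ _ hy fun m hm q _ => by
    rw [hm, Option.some_or]

theorem multiBroadcast_eq_none (hf : ∀ v, f v = none) :
    multiBroadcast G h part f coins v = none := by
  refine Option.eq_none_iff_forall_ne_some.2 fun y hy => ?_
  obtain ⟨u, hu⟩ := exists_of_multiBroadcast_eq_some hy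
  exact absurd ((hf u).symm.trans hu) (Option.some_ne_none y).symm

end Origin

section ConflictLoop

variable {V : Type*} {b l : ℕ} {G : Digraph V} {v : V}

/-- The second phase of Selection, which goes through the bits of the strings `m`: the resulting
strings, and the set of witnesses of a conflict. -/
noncomputable def conflictLoop (G : Digraph V) (coins : Fin b → Fin 4 → DecayCoins V l)
    (m : V → Option (BitString b)) : V → Option (BitString b) × Bool :=
  (List.finRange b).foldl (fun s j => conflictStep G j (coins j) s) fun v => (m v, false)

section Step

variable {j : Fin b} {coins : Fin 4 → DecayCoins V l} {s : V → Option (BitString b) × Bool}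

theorem conflictStep_snd (hv : (s v).2 = true) : (conflictStep G j coins s v).2 = true := by
  unfold conflictStep
  split
  · exact hv
  · dsimp only
    split
    exacts [rfl, hv]

theorem conflictStep_eq_of_snd_eq_false (hv : (conflictStep G j coins s v).2 = false) :
    conflictStep G j coins s v = s v := by
  unfold conflictStep at hv ⊢
  split at hv
  · rfl
  · dsimp only at hv ⊢
    split at hv
    exacts [Bool.noConfusion hv, rfl]

theorem conflictStep_fst_ne_none (hv : (s v).1 ≠ none) : (conflictStep G j coins s v).1 ≠ none := by
  unfold conflictStep
  split
  · exact hv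
  · dsimp only
    split
    exacts [Option.some_ne_none _, hv]

theorem decay_eq_none_of_conflictStep_eq_self {m : V → Option (BitString b)} {y : BitString b}
    (hv : m v = some y) (hy : y j = false)
    (hfix : conflictStep G j coins (fun v => (m v, false)) = fun v => (m v, false)) (r : Fin 4) :
    decay G l (fun u => (m u).filter fun x => x j) (coins r) v = none := by
  by_contra hne
  have hheard : ((List.finRange 4).findSome? fun r =>
      decay G l (fun u => (m u).filter fun x => x j) (coins r) v).isSome :=
    List.findSome?_isSome_iff.2 ⟨r, List.mem_finRange r, Option.isSome_iff_ne_none.2 hne⟩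
  obtain ⟨z, hz⟩ := Option.isSome_iff_exists.1 hheard
  have hwitness : (conflictStep G j coins (fun v => (m v, false)) v).2 = true := by
    simp only [conflictStep, hv, hy, hz]
  rw [hfix] at hwitness
  exact Bool.noConfusion hwitness

theorem conflictStep_of_forall_eq {m : V → Option (BitString b)} {x : BitString b}
    (hm : ∀ v y, m v = some y → y = x) :
    conflictStep G j coins (fun v => (m v, false)) = fun v => (m v, false) := by
  funext v
  unfold conflictStep
  split
  · rfl
  · rename_i y hy
    dsimp only at hy ⊢
    split
    · rename_i z hyj hz
      obtain ⟨r, -, hr⟩ := List.exists_of_findSome?_eq_some hz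
      obtain ⟨u, hu⟩ := exists_of_decay_eq_some hr
      obtain ⟨hu, hzj⟩ := Option.filter_eq_some_iff.1 hu
      rw [hm v y hy] at hyj
      rw [hm u z hu, hyj] at hzj
      exact Bool.noConfusion hzj
    · rfl

end Step

variable {coins : Fin b → Fin 4 → DecayCoins V l} {m : V → Option (BitString b)}

theorem conflictLoop_fst_ne_none (hv : m v ≠ none) : (conflictLoop G coins m v).1 ≠ none :=
  List.foldlRecOn (motive := fun s : V → Option (BitString b) × Bool => (s v).1 ≠ none) _ _ hv
    fun _ hs _ _ => conflictStep_fst_ne_none hs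

theorem conflictLoop_of_forall_eq {x : BitString b} (hm : ∀ v y, m v = some y → y = x) :
    conflictLoop G coins m = fun v => (m v, false) :=
  List.foldlRecOn (motive := fun s => s = fun v => (m v, false)) _ _ rfl
    fun _ hs _ _ => by rw [hs, conflictStep_of_forall_eq hm]

theorem conflictStep_eq_self_of_mem {L : List (Fin b)} {s : V → Option (BitString b) × Bool}
    (hL : ∀ v, (L.foldl (fun s j => conflictStep G j (coins j) s) s v).2 = false) :
    ∀ j ∈ L, conflictStep G j (coins j) s = s := by
  induction L generalizing s with
  | nil => exact fun j hj => absurd hj List.not_mem_nil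
  | cons i L ih =>
    have hi : conflictStep G i (coins i) s = s := by
      refine funext fun v => conflictStep_eq_of_snd_eq_false ?_
      by_contra hne
      have hwitness := List.foldlRecOn (motive := fun s => (s v).2 = true) L
        (fun s j => conflictStep G j (coins j) s) (Bool.eq_true_of_not_eq_false hne)
        fun _ hs _ _ => conflictStep_snd hs
      exact Bool.noConfusion ((hL v).symm.trans hwitness)
    rw [List.forall_mem_cons]
    refine ⟨hi, ih fun v => ?_⟩
    rw [← hL v, List.foldl_cons, hi]

/-- A bound for the probability that a node with bit `y` hears none of its in-neighbours with bit
`x`. -/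
noncomputable def missBound (x y : Bool) : ℝ≥0∞ :=
  if x && !y then ENNReal.ofReal (0.82 ^ 4) else 1

theorem measure_conflictLoop_le [Fintype V] (hl : 0 < l) (hV : Fintype.card V ≤ 2 ^ l) {u : V}
    (huv : G.Adj u v) {x y : BitString b} (hu : m u = some x) (hv : m v = some y) :
    (Measure.pi fun _ : Fin b => Measure.pi fun _ : Fin 4 => decayLaw V l)
        {coins | ∀ w, (conflictLoop G coins m w).2 = false} ≤
      ∏ j, missBound (x j) (y j) := by
  let miss (j : Fin b) : Set (Fin 4 → DecayCoins V l) :=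
    if x j && !y j then
      Set.univ.pi fun _ => {coins | decay G l (fun u => (m u).filter fun z => z j) coins v = none}
    else Set.univ
  have hsub : {coins : Fin b → Fin 4 → DecayCoins V l |
      ∀ w, (conflictLoop G coins m w).2 = false} ⊆ Set.univ.pi miss := by
    intro coins hcoins j _
    have hfix := conflictStep_eq_self_of_mem hcoins j (List.mem_finRange j)
    dsimp only [miss]
    split_ifs with hj
    · rw [Bool.and_eq_true, Bool.not_eq_true'] at hj
      exact fun r _ => decay_eq_none_of_conflictStep_eq_self hv hj.2 hfix r
    · trivial
  refine (measure_mono hsub).trans ?_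
  rw [Measure.pi_pi]
  refine Finset.prod_le_prod' fun j _ => ?_
  dsimp only [miss, missBound]
  split_ifs with hj
  · rw [Bool.and_eq_true, Bool.not_eq_true'] at hj
    rw [Measure.pi_pi, ENNReal.ofReal_pow (by norm_num)]
    refine (Finset.prod_le_pow_card _ _ (ENNReal.ofReal 0.82) fun r _ => ?_).trans_eq (by simp)
    exact decayLaw_decay_eq_none_le (by simp [hv, hj.2]) ⟨u, huv, by simp [hu, hj.1]⟩
      (fun w _ _ => Finset.mem_univ w) (by rwa [Finset.card_univ]) hl le_rfl
  · exact prob_le_one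

end ConflictLoop

/-! ### Random identifiers -/

section Identifiers

section Pi

variable {ι : Type*} [Fintype ι] {X : ι → Type*} [∀ i, MeasurableSpace (X i)]
  (μ : ∀ i, Measure (X i)) [∀ i, IsProbabilityMeasure (μ i)]

theorem lintegral_pi_prod {φ : ∀ i, X i → ℝ≥0∞} (hφ : ∀ i, Measurable (φ i)) :
    ∫⁻ x, ∏ i, φ i (x i) ∂(Measure.pi μ) = ∏ i, ∫⁻ x, φ i x ∂(μ i) := by
  rw [lintegral_prod_eq_prod_lintegral_of_indepFun Finset.univ (fun i (x : ∀ i, X i) => φ i (x i))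
    (iIndepFun_pi fun i => (hφ i).aemeasurable) fun i => (hφ i).comp (measurable_pi_apply i)]
  exact Finset.prod_congr rfl fun i _ => (measurePreserving_eval μ i).lintegral_comp (hφ i)

theorem lintegral_pi_pair {i j : ι} (hij : i ≠ j) {φ : X i → X j → ℝ≥0∞}
    (hφ : Measurable (Function.uncurry φ)) :
    ∫⁻ x, φ (x i) (x j) ∂(Measure.pi μ) = ∫⁻ x, ∫⁻ y, φ x y ∂(μ j) ∂(μ i) := by
  have hpair := Measure.infinitePi_map_eval_prod (P := μ) hij
  rw [Measure.infinitePi_eq_pi] at hpair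
  calc ∫⁻ x, φ (x i) (x j) ∂(Measure.pi μ)
      = ∫⁻ z, Function.uncurry φ z ∂(Measure.pi μ).map fun x => (x i, x j) :=
        (lintegral_map hφ ((measurable_pi_apply i).prodMk (measurable_pi_apply j))).symm
    _ = ∫⁻ x, ∫⁻ y, φ x y ∂(μ j) ∂(μ i) := by
        rw [hpair, lintegral_prod _ hφ.aemeasurable]
        rfl

end Pi

theorem lintegral_coin_two (φ : Bool → ℝ≥0∞) :
    ∫⁻ x, φ x ∂(coin 2) = ENNReal.ofReal 2⁻¹ * (φ true + φ false) := by
  have hfalse : coin 2 {false} = ENNReal.ofReal 2⁻¹ := by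
    rw [show ({false} : Set Bool) = {true}ᶜ by ext x; cases x <;> simp,
      prob_compl_eq_one_sub (MeasurableSet.singleton true), coin_true, Nat.cast_two,
      ← ENNReal.ofReal_one, ← ENNReal.ofReal_sub _ (by norm_num)]
    norm_num
  rw [lintegral_fintype, Fintype.sum_bool, hfalse, coin_true, Nat.cast_two]
  ring

/-- The rate per bit at which the probability decreases that a conflict between two random
identifiers remains undetected. -/
noncomputable def missRate : ℝ := (3 + 0.82 ^ 4) / 4

theorem lintegral_missBound :
    ∫⁻ x, ∫⁻ y, missBound x y ∂(coin 2) ∂(coin 2) = ENNReal.ofReal missRate := by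
  simp only [lintegral_coin_two, missBound, missRate, Bool.not_true, Bool.and_false, Bool.not_false,
    Bool.and_true, Bool.false_eq_true, if_false, if_true, ← ENNReal.ofReal_one]
  rw [← ENNReal.ofReal_add (by norm_num) (by norm_num),
    ← ENNReal.ofReal_add (by norm_num) (by norm_num), ← ENNReal.ofReal_mul (by norm_num),
    ← ENNReal.ofReal_mul (by norm_num), ← ENNReal.ofReal_add (by norm_num) (by norm_num),
    ← ENNReal.ofReal_mul (by norm_num)]
  norm_num

theorem lintegral_prod_missBound {V : Type*} [Fintype V] (b : ℕ) {v w : V} (hvw : v ≠ w) :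
    ∫⁻ ids : V → BitString b, ∏ j, missBound (ids v j) (ids w j)
        ∂(Measure.pi fun _ => Measure.pi fun _ => coin 2) =
      ENNReal.ofReal (missRate ^ b) := by
  rw [lintegral_pi_pair (X := fun _ => BitString b) _ hvw
    (φ := fun x y => ∏ j, missBound (x j) (y j)) .of_discrete]
  calc ∫⁻ x : BitString b, ∫⁻ y : BitString b, ∏ j, missBound (x j) (y j)
        ∂(Measure.pi fun _ => coin 2) ∂(Measure.pi fun _ => coin 2)
      = ∫⁻ x : BitString b, ∏ j, ∫⁻ y, missBound (x j) y ∂(coin 2)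
          ∂(Measure.pi fun _ => coin 2) :=
        lintegral_congr fun x => lintegral_pi_prod _ fun _ => .of_discrete
    _ = ∏ _j : Fin b, ∫⁻ x, ∫⁻ y, missBound x y ∂(coin 2) ∂(coin 2) :=
        lintegral_pi_prod (φ := fun _ x => ∫⁻ y, missBound x y ∂(coin 2)) _ fun _ => .of_discrete
    _ = ENNReal.ofReal (missRate ^ b) := by
        simp only [lintegral_missBound, Finset.prod_const, Finset.card_univ, Fintype.card_fin]
        rw [ENNReal.ofReal_pow (by unfold missRate; norm_num)]

theorem missRate_pow_idLength_le (c : ℕ) {n : ℕ} (hn : 0 < n) :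
    missRate ^ idLength c n ≤ ((n : ℝ) ^ (3 * c))⁻¹ := by
  have hrate : missRate ^ 16 ≤ (2 ^ 3 : ℝ)⁻¹ := by unfold missRate; norm_num
  calc missRate ^ idLength c n = (missRate ^ 16) ^ (c * logSize n) := by
        rw [idLength, mul_assoc, pow_mul]
    _ ≤ ((2 ^ 3 : ℝ)⁻¹) ^ (c * logSize n) :=
        pow_le_pow_left₀ (pow_nonneg (by unfold missRate; norm_num) 16) hrate _
    _ = ((2 ^ logSize n : ℝ) ^ (3 * c))⁻¹ := by
        rw [inv_pow, ← pow_mul, ← pow_mul]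
        ring_nf
    _ ≤ ((n : ℝ) ^ (3 * c))⁻¹ := by
        gcongr
        exact_mod_cast le_two_pow_logSize n

end Identifiers

/-! ### Selection and the main loop -/

section Selection

variable {V : Type*} {b l Q : ℕ} {G : Digraph V} {h : ℕ → ℕ} {act : V → Bool}
  {ids : V → Option (BitString b)} {c₁ c₃ : Fin Q → DecayCoins V l}
  {c₂ : Fin b → Fin 4 → DecayCoins V l} {v : V}

/-- The strings of the witnesses, which are the sources of the second broadcast of Selection. -/
def witnessString (s : V → Option (BitString b) × Bool) (v : V) : Option (BitString b) :=
  if (s v).2 then (s v).1 else none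

/-- The strings after the second broadcast of Selection, where `m` are those after the first. -/
noncomputable def secondStrings (G : Digraph V) (h : ℕ → ℕ) (m : V → Option (BitString b))
    (c₂ : Fin b → Fin 4 → DecayCoins V l) (c₃ : Fin Q → DecayCoins V l) :
    V → Option (BitString b) :=
  multiBroadcast G h (fun v => (m v).isSome) (witnessString (conflictLoop G c₂ m)) c₃

theorem selection_apply :
    selection G h act ids c₁ c₂ c₃ v =
      match multiBroadcast G h act ids c₁ v,
        secondStrings G h (multiBroadcast G h act ids c₁) c₂ c₃ v with
      | none, _ => (none, false)
      | some _, none => ((conflictLoop G c₂ (multiBroadcast G h act ids c₁) v).1, true)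
      | some _, some y => (some y, false) := rfl

theorem selection_of_forall_eq {x : BitString b} (hids : ∀ v y, ids v = some y → y = x)
    (hv : multiBroadcast G h act ids c₁ v ≠ none) :
    selection G h act ids c₁ c₂ c₃ v = (some x, true) := by
  have hm : ∀ w y, multiBroadcast G h act ids c₁ w = some y → y = x := fun w y hy =>
    (exists_of_multiBroadcast_eq_some hy).elim fun u hu => hids u y hu
  obtain ⟨y, hy⟩ := Option.ne_none_iff_exists'.1 hv
  have hloop := conflictLoop_of_forall_eq (G := G) (coins := c₂) hm
  have hsecond : secondStrings G h (multiBroadcast G h act ids c₁) c₂ c₃ v = none :=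
    multiBroadcast_eq_none fun w => by rw [witnessString, hloop]; rfl
  rw [selection_apply, hsecond, hloop, hy]
  dsimp only
  rw [hy, hm v y hy]

theorem selection_snd_of_secondStrings_ne_none
    (hv : secondStrings G h (multiBroadcast G h act ids c₁) c₂ c₃ v ≠ none) :
    (selection G h act ids c₁ c₂ c₃ v).2 = false := by
  obtain ⟨y, hy⟩ := Option.ne_none_iff_exists'.1 hv
  rw [selection_apply, hy]
  split
  exacts [rfl, by contradiction, rfl]

theorem selection_snd_of_eq_none (hv : multiBroadcast G h act ids c₁ v = none) :
    (selection G h act ids c₁ c₂ c₃ v).2 = false := by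
  rw [selection_apply, hv]

end Selection

section Iteration

variable {V : Type*} {b l Q : ℕ} {G : Digraph V} {h : ℕ → ℕ} {st : V → Status b}
  {r : IterationCoins V b l Q} {v w : V}

/-- The identifiers that are broadcast if `a` is the set of candidates. -/
def candidateIds (a : V → Bool) (x : V → BitString b) (v : V) : Option (BitString b) :=
  if a v then some (x v) else none

theorem candidateIds_eq_some {a : V → Bool} {x : V → BitString b} {y : BitString b} :
    candidateIds a x v = some y ↔ a v = true ∧ x v = y := by
  rw [candidateIds, Option.ite_none_right_eq_some, Option.some_inj]

/-- Only `v` tosses that it becomes a candidate. -/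
def OnlyCandidate (a : V → Bool) (v : V) : Prop := a v = true ∧ ∀ w, w ≠ v → a w = false

/-- The identifiers that the running nodes broadcast in an iteration. -/
def runningIds (st : V → Status b) (r : IterationCoins V b l Q) : V → Option (BitString b) :=
  candidateIds (fun v => (st v).isNone && r.1 v) r.2.1

theorem iteration_apply :
    iteration G h st r v =
      if (st v).isNone then
        match selection G h (fun v => (st v).isNone) (runningIds st r) r.2.2.1 r.2.2.2.1
          r.2.2.2.2 v with
        | (some y, true) => some (y, runningIds st r v)
        | _ => none
      else st v := rfl

theorem iteration_of_isSome (hv : (st v).isSome) : iteration G h st r v = st v := by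
  rw [iteration_apply, if_neg (by simpa [← Option.isSome_iff_ne_none] using hv)]

theorem iteration_eq_none (hv : st v = none)
    (hsel : (selection G h (fun v => (st v).isNone) (runningIds st r) r.2.2.1 r.2.2.2.1
      r.2.2.2.2 v).2 = false) : iteration G h st r v = none := by
  rw [iteration_apply, hv, Option.isNone_none, if_pos rfl]
  split
  · rename_i hsome
    rw [hsome] at hsel
    exact Bool.noConfusion hsel
  · rfl

theorem iteration_of_onlyCandidate (hv : OnlyCandidate r.1 v) (hw : st w = none)
    (hm : multiBroadcast G h (fun v => (st v).isNone) (runningIds st r) r.2.2.1 w ≠ none) :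
    iteration G h st r w = some (r.2.1 v, runningIds st r w) := by
  have hids : ∀ u y, runningIds st r u = some y → y = r.2.1 v := by
    intro u y hu
    obtain ⟨hcand, rfl⟩ := candidateIds_eq_some.1 hu
    by_cases huv : u = v
    · rw [huv]
    · simp [hv.2 u huv] at hcand
  rw [iteration_apply, selection_of_forall_eq hids hm, hw]
  rfl

theorem iteration_isSome_of_onlyCandidate (hv : OnlyCandidate r.1 v) (hst : st v = none) :
    (iteration G h st r v).isSome := by
  have hid : runningIds st r v = some (r.2.1 v) :=
    candidateIds_eq_some.2 ⟨by simp [hst, hv.1], rfl⟩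
  rw [iteration_of_onlyCandidate hv hst
    (by rw [multiBroadcast_of_eq_some hid]; exact Option.some_ne_none _)]
  rfl

/-- The status of all nodes at the beginning. -/
def initial (V : Type*) (b : ℕ) : V → Status b := fun _ => none

/-- All nodes have terminated with the same output, which is the own identifier of exactly one of
them. -/
def Elected (st : V → Status b) : Prop :=
  ∃ y : BitString b, (∀ v, ∃ own, st v = some (y, own)) ∧ ∃! v, st v = some (y, some y)

theorem Elected.isSome (hst : Elected st) (v : V) : (st v).isSome := by
  obtain ⟨y, hy, -⟩ := hst
  obtain ⟨own, hown⟩ := hy v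
  rw [hown, Option.isSome_some]

theorem Elected.iteration_eq (hst : Elected st) : iteration G h st r = st :=
  funext fun v => iteration_of_isSome (hst.isSome v)

/-- The strings after the first broadcast of an iteration in which all nodes are running. -/
noncomputable def firstStrings (G : Digraph V) (h : ℕ → ℕ) (a : V → Bool) (x : V → BitString b)
    (c₁ : Fin Q → DecayCoins V l) : V → Option (BitString b) :=
  multiBroadcast G h (fun _ => true) (candidateIds a x) c₁

/-- There is a candidate, but the first broadcast does not reach all nodes. -/
def FirstBroadcastFails (G : Digraph V) (h : ℕ → ℕ) : IterationCoins V b l Q → Prop :=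
  fun (a, x, c₁, _, _) => (∃ v, a v = true) ∧ ∃ v, firstStrings G h a x c₁ v = none

/-- There are several candidates, and the first broadcast reaches all nodes, but no conflict is
detected. -/
def DetectionFails (G : Digraph V) (h : ℕ → ℕ) : IterationCoins V b l Q → Prop :=
  fun (a, x, c₁, c₂, _) =>
    (∀ v, firstStrings G h a x c₁ v ≠ none) ∧ (∃ v w, v ≠ w ∧ a v = true ∧ a w = true) ∧
      ∀ v, (conflictLoop G c₂ (firstStrings G h a x c₁) v).2 = false

/-- A conflict is detected, but the second broadcast does not reach all nodes. -/
def SecondBroadcastFails (G : Digraph V) (h : ℕ → ℕ) : IterationCoins V b l Q → Prop :=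
  fun (a, x, c₁, c₂, c₃) =>
    (∀ v, firstStrings G h a x c₁ v ≠ none) ∧
      (∃ v, (conflictLoop G c₂ (firstStrings G h a x c₁) v).2 = true) ∧
      ∃ v, secondStrings G h (firstStrings G h a x c₁) c₂ c₃ v = none

theorem elected_iteration_of_onlyCandidate (hv : OnlyCandidate r.1 v)
    (hr : ¬FirstBroadcastFails G h r) : Elected (iteration G h (initial V b) r) := by
  have hiter (w : V) : iteration G h (initial V b) r w =
      some (r.2.1 v, candidateIds r.1 r.2.1 w) :=
    iteration_of_onlyCandidate hv rfl fun hw => hr ⟨⟨v, hv.1⟩, w, hw⟩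
  refine ⟨r.2.1 v, fun w => ⟨_, hiter w⟩, v, ?_, fun w hw => ?_⟩
  · dsimp only
    rw [hiter, candidateIds_eq_some.2 ⟨hv.1, rfl⟩]
  · by_contra hwv
    dsimp only at hw
    rw [hiter, Option.some_inj, Prod.mk_right_inj, candidateIds_eq_some, hv.2 w hwv] at hw
    exact Bool.noConfusion hw.1

theorem iteration_initial_eq_or_elected (h₁ : ¬FirstBroadcastFails G h r)
    (h₂ : ¬DetectionFails G h r) (h₃ : ¬SecondBroadcastFails G h r) :
    iteration G h (initial V b) r = initial V b ∨ Elected (iteration G h (initial V b) r) := by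
  by_cases hcand : ∃ v, r.1 v = true
  · have hall (w : V) : firstStrings G h r.1 r.2.1 r.2.2.1 w ≠ none := fun hw => h₁ ⟨hcand, w, hw⟩
    obtain ⟨v, hv⟩ := hcand
    by_cases honly : ∀ w, w ≠ v → r.1 w = false
    · exact .inr (elected_iteration_of_onlyCandidate ⟨hv, honly⟩ h₁)
    · push Not at honly
      obtain ⟨w, hwv, hw⟩ := honly
      have hwitness :
          ∃ u, (conflictLoop G r.2.2.2.1 (firstStrings G h r.1 r.2.1 r.2.2.1) u).2 = true := by
        by_contra! hno
        exact h₂ ⟨hall, ⟨w, v, hwv, Bool.eq_true_of_not_eq_false hw, hv⟩,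
          fun u => Bool.eq_false_of_not_eq_true (hno u)⟩
      exact .inl <| funext fun u => iteration_eq_none rfl <|
        selection_snd_of_secondStrings_ne_none fun hu => h₃ ⟨hall, hwitness, u, hu⟩
  · refine .inl <| funext fun u => iteration_eq_none rfl <| selection_snd_of_eq_none <|
      multiBroadcast_eq_none fun w => Option.eq_none_iff_forall_ne_some.2 fun y hy => ?_
    exact hcand ⟨w, (candidateIds_eq_some.1 hy).1⟩

end Iteration

/-! ### Failure probabilities of one iteration -/

section Prod

variable {X Y : Type*} [MeasurableSpace X] [MeasurableSpace Y] [Countable X] [Countable Y]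
  [MeasurableSingletonClass X] [MeasurableSingletonClass Y] {μ : Measure X} {ν : Measure Y}
  [SFinite ν] {S : Set (X × Y)}

theorem measure_prod_le_lintegral {ε : X → ℝ≥0∞} (h : ∀ x, ν {y | (x, y) ∈ S} ≤ ε x) :
    μ.prod ν S ≤ ∫⁻ x, ε x ∂μ :=
  (Measure.prod_apply .of_discrete).trans_le (lintegral_mono h)

theorem measure_prod_le_of_forall [IsProbabilityMeasure μ] {ε : ℝ≥0∞}
    (h : ∀ x, ν {y | (x, y) ∈ S} ≤ ε) : μ.prod ν S ≤ ε :=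
  (measure_prod_le_lintegral h).trans_eq (by simp)

end Prod

theorem StronglyConnected.exists_adj_ne {V M : Type*} {G : Digraph V} (hG : StronglyConnected G)
    {m : V → M} {v w : V} (hvw : m v ≠ m w) : ∃ u u', G.Adj u u' ∧ m u ≠ m u' := by
  by_contra! hno
  refine hvw ?_
  clear hvw
  induction hG v w with
  | refl => rfl
  | tail _ hadj ih => exact ih.trans (hno _ _ hadj)

section Failure

variable {V : Type*} [Fintype V] {b l Q n : ℕ} {G : Digraph V} {h : ℕ → ℕ}

section Broadcast

variable {δ : ℝ≥0∞}
  (hδ : ∀ f : V → Option (BitString b), (∃ v, f v ≠ none) →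
    (Measure.pi fun _ : Fin Q => decayLaw V l)
      {coins | ∃ v, multiBroadcast G h (fun _ => true) f coins v = none} ≤ δ)

include hδ

theorem iterationLaw_firstBroadcastFails_le :
    iterationLaw V n b l Q {r | FirstBroadcastFails G h r} ≤ δ := by
  refine measure_prod_le_of_forall fun a => measure_prod_le_of_forall fun x => ?_
  by_cases ha : ∃ v, a v = true
  · obtain ⟨v, hv⟩ := ha
    have hsource : candidateIds a x v ≠ none := by
      rw [candidateIds_eq_some.2 ⟨hv, rfl⟩]
      exact Option.some_ne_none _
    calc _ ≤ _ := measure_mono fun z hz => hz.2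
      _ = _ := measurePreserving_fst.measure_preimage MeasurableSet.of_discrete.nullMeasurableSet
      _ ≤ δ := hδ (candidateIds a x) ⟨v, hsource⟩
  · exact (measure_mono_null (fun z hz => ha hz.1) measure_empty).trans_le zero_le

theorem iterationLaw_secondBroadcastFails_le :
    iterationLaw V n b l Q {r | SecondBroadcastFails G h r} ≤ δ := by
  refine measure_prod_le_of_forall fun a => measure_prod_le_of_forall fun x =>
    measure_prod_le_of_forall fun c₁ => measure_prod_le_of_forall fun c₂ => ?_
  let m := firstStrings G h a x c₁
  by_cases hm : (∀ v, m v ≠ none) ∧ ∃ v, (conflictLoop G c₂ m v).2 = true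
  · obtain ⟨hm, v, hv⟩ := hm
    have hpart : (fun v => (m v).isSome) = fun _ => true :=
      funext fun v => Option.isSome_iff_ne_none.2 (hm v)
    have hsource : witnessString (conflictLoop G c₂ m) v ≠ none := by
      rw [witnessString, if_pos hv]
      exact conflictLoop_fst_ne_none (hm v)
    refine (measure_mono fun c₃ hc₃ => ?_).trans (hδ (witnessString (conflictLoop G c₂ m))
      ⟨v, hsource⟩)
    rw [← hpart]
    exact hc₃.2.2
  · exact (measure_mono_null (fun z hz => hm ⟨hz.1, hz.2.1⟩) measure_empty).trans_le zero_le

end Broadcast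

open Classical in
/-- The sum over all pairs of distinct candidates of the bounds for the probability that no
difference of their strings is detected. -/
noncomputable def pairBound (a : V → Bool) (x : V → BitString b) : ℝ≥0∞ :=
  ∑ z ∈ (Finset.univ : Finset V).offDiag,
    (if a z.1 && a z.2 then 1 else 0) * ∏ j, missBound (x z.1 j) (x z.2 j)

theorem le_pairBound {a : V → Bool} {x : V → BitString b} {v w : V} (hvw : v ≠ w)
    (hv : a v = true) (hw : a w = true) :
    ∏ j, missBound (x v j) (x w j) ≤ pairBound a x := by
  classical
  calc ∏ j, missBound (x v j) (x w j)
      = (if a v && a w then 1 else 0) * ∏ j, missBound (x v j) (x w j) := by simp [hv, hw]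
    _ ≤ pairBound a x := by
        have hmem : (v, w) ∈ (Finset.univ : Finset V).offDiag := by simp [hvw]
        exact Finset.single_le_sum (f := fun z : V × V =>
          (if a z.1 && a z.2 then (1 : ℝ≥0∞) else 0) * ∏ j, missBound (x z.1 j) (x z.2 j))
          (fun _ _ => zero_le) hmem

theorem measure_conflictLoop_le_pairBound (hG : StronglyConnected G) (hl : 0 < l)
    (hV : Fintype.card V ≤ 2 ^ l) {a : V → Bool} {x : V → BitString b}
    {c₁ : Fin Q → DecayCoins V l} (hm : ∀ v, firstStrings G h a x c₁ v ≠ none)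
    (hpair : ∃ v w, v ≠ w ∧ a v = true ∧ a w = true) :
    (Measure.pi fun _ : Fin b => Measure.pi fun _ : Fin 4 => decayLaw V l)
        {coins | ∀ v, (conflictLoop G coins (firstStrings G h a x c₁) v).2 = false} ≤
      pairBound a x := by
  -- If two candidates have equal strings, then already their term of `pairBound` is `1`.
  -- Otherwise different strings of two candidates meet across some edge.
  obtain ⟨v, w, hvw, hv, hw⟩ := hpair
  have hown {v : V} (hv : a v = true) : firstStrings G h a x c₁ v = some (x v) :=
    multiBroadcast_of_eq_some (candidateIds_eq_some.2 ⟨hv, rfl⟩)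
  by_cases heq : x v = x w
  · calc _ ≤ (1 : ℝ≥0∞) := prob_le_one
      _ = ∏ j, missBound (x v j) (x w j) := by simp [heq, missBound]
      _ ≤ pairBound a x := le_pairBound hvw hv hw
  · obtain ⟨u, u', hadj, hne⟩ := hG.exists_adj_ne (m := firstStrings G h a x c₁) (v := v) (w := w)
      (by rwa [hown hv, hown hw, Ne, Option.some_inj])
    have horigin (u : V) : ∃ z, a z = true ∧ firstStrings G h a x c₁ u = some (x z) := by
      obtain ⟨y, hy⟩ := Option.ne_none_iff_exists'.1 (hm u)
      obtain ⟨z, hz⟩ := exists_of_multiBroadcast_eq_some hy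
      obtain ⟨haz, rfl⟩ := candidateIds_eq_some.1 hz
      exact ⟨z, haz, hy⟩
    obtain ⟨z, hz, hu⟩ := horigin u
    obtain ⟨z', hz', hu'⟩ := horigin u'
    have hzz' : z ≠ z' := by
      rintro rfl
      exact hne (hu.trans hu'.symm)
    exact (measure_conflictLoop_le hl hV hadj hu hu').trans (le_pairBound hzz' hz hz')

theorem lintegral_both_true {v w : V} (hvw : v ≠ w) :
    ∫⁻ a : V → Bool, (if a v && a w then 1 else 0) ∂(Measure.pi fun _ => coin n) =
      ENNReal.ofReal ((n : ℝ)⁻¹ * (n : ℝ)⁻¹) := by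
  rw [lintegral_pi_pair (X := fun _ => Bool) _ hvw
    (φ := fun s t => if s && t then 1 else 0) .of_discrete]
  simp [lintegral_fintype, coin_true, ENNReal.ofReal_mul]

theorem lintegral_pairBound_le [Nonempty V] :
    ∫⁻ a : V → Bool, ∫⁻ x : V → BitString b, pairBound a x
        ∂(Measure.pi fun _ => Measure.pi fun _ => coin 2)
        ∂(Measure.pi fun _ => coin (Fintype.card V)) ≤ ENNReal.ofReal (missRate ^ b) := by
  classical
  have hterm : ∀ z ∈ (Finset.univ : Finset V).offDiag,
      ∫⁻ a : V → Bool, ∫⁻ x : V → BitString b,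
          (if a z.1 && a z.2 then 1 else 0) * ∏ j, missBound (x z.1 j) (x z.2 j)
        ∂(Measure.pi fun _ => Measure.pi fun _ => coin 2)
        ∂(Measure.pi fun _ => coin (Fintype.card V)) =
      ENNReal.ofReal ((Fintype.card V : ℝ)⁻¹ * (Fintype.card V : ℝ)⁻¹) *
        ENNReal.ofReal (missRate ^ b) := by
    intro z hz
    have hz : z.1 ≠ z.2 := (Finset.mem_offDiag.1 hz).2.2
    simp_rw [lintegral_const_mul _ (Measurable.of_discrete (f := fun x : V → BitString b =>
      ∏ j, missBound (x z.1 j) (x z.2 j))), lintegral_prod_missBound b hz]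
    rw [lintegral_mul_const _ .of_discrete, lintegral_both_true hz]
  have hcard : ((Finset.univ : Finset V).offDiag.card : ℝ) ≤ Fintype.card V * Fintype.card V := by
    rw [Finset.offDiag_card, Finset.card_univ]
    exact_mod_cast Nat.sub_le _ _
  have hV : (Fintype.card V : ℝ) ≠ 0 := Nat.cast_ne_zero.2 Fintype.card_ne_zero
  simp only [pairBound, lintegral_finsetSum _ fun _ _ => Measurable.of_discrete]
  rw [Finset.sum_congr (by congr!) hterm, Finset.sum_const, nsmul_eq_mul, ← mul_assoc]
  refine mul_le_of_le_one_left zero_le ?_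
  rw [← ENNReal.ofReal_natCast, ← ENNReal.ofReal_mul (Nat.cast_nonneg _), ENNReal.ofReal_le_one]
  calc _ ≤ (Fintype.card V : ℝ) * Fintype.card V *
        ((Fintype.card V : ℝ)⁻¹ * (Fintype.card V : ℝ)⁻¹) := by gcongr
    _ = 1 := by field_simp

theorem iterationLaw_detectionFails_le [Nonempty V] (hG : StronglyConnected G) (hl : 0 < l)
    (hV : Fintype.card V ≤ 2 ^ l) :
    iterationLaw V (Fintype.card V) b l Q {r | DetectionFails G h r} ≤
      ENNReal.ofReal (missRate ^ b) := by
  refine (measure_prod_le_lintegral fun a => measure_prod_le_lintegral (ε := pairBound a) fun x =>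
    measure_prod_le_of_forall fun c₁ => ?_).trans lintegral_pairBound_le
  by_cases hm : (∀ v, firstStrings G h a x c₁ v ≠ none) ∧ ∃ v w, v ≠ w ∧ a v = true ∧ a w = true
  · calc _ ≤ _ := measure_mono fun z hz => hz.2.2
      _ = _ := measurePreserving_fst.measure_preimage MeasurableSet.of_discrete.nullMeasurableSet
      _ ≤ pairBound a x := measure_conflictLoop_le_pairBound hG hl hV hm.1 hm.2
  · exact (measure_mono_null (fun z hz => hm ⟨hz.1, hz.2.1⟩) measure_empty).trans_le zero_le

section Candidate

variable [Nontrivial V]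

theorem le_coin_true_mul_coin_compl_pow :
    ENNReal.ofReal ((Fintype.card V : ℝ)⁻¹ * Real.exp (-1)) ≤
      coin (Fintype.card V) {true} *
        coin (Fintype.card V) {true}ᶜ ^ ((Finset.univ : Finset V).card - 1) := by
  refine le_measure_mul_measure_compl_pow _ (MeasurableSet.singleton true)
    (Nat.one_lt_cast.2 Fintype.one_lt_card) (coin_true _) ?_
  rw [Finset.card_univ, Nat.cast_pred Fintype.card_pos]

theorem le_iterationLaw_onlyCandidate (v : V) :
    ENNReal.ofReal ((Fintype.card V : ℝ)⁻¹ * Real.exp (-1)) ≤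
      iterationLaw V (Fintype.card V) b l Q {r | OnlyCandidate r.1 v} :=
  calc _ ≤ _ := le_coin_true_mul_coin_compl_pow
    _ = _ := (measure_pi_only _ (Finset.mem_univ v)).symm
    _ = (Measure.pi fun _ => coin (Fintype.card V)) {a | OnlyCandidate a v} := by
        simp [OnlyCandidate]
    _ = _ := (measurePreserving_fst.measure_preimage
        MeasurableSet.of_discrete.nullMeasurableSet).symm

theorem le_iterationLaw_exists_onlyCandidate :
    ENNReal.ofReal (Real.exp (-1)) ≤
      iterationLaw V (Fintype.card V) b l Q {r | ∃ v, OnlyCandidate r.1 v} :=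
  calc ENNReal.ofReal (Real.exp (-1))
      = (Finset.univ : Finset V).card *
          ENNReal.ofReal ((Fintype.card V : ℝ)⁻¹ * Real.exp (-1)) := by
        rw [Finset.card_univ, ← ENNReal.ofReal_natCast, ← ENNReal.ofReal_mul (Nat.cast_nonneg _),
          mul_inv_cancel_left₀ (Nat.cast_ne_zero.2 Fintype.card_ne_zero)]
    _ ≤ _ := mul_le_mul_right le_coin_true_mul_coin_compl_pow _
    _ = _ := (measure_pi_exists_only _ (MeasurableSet.singleton true) Finset.univ).symm
    _ = (Measure.pi fun _ => coin (Fintype.card V)) {a | ∃ v, OnlyCandidate a v} := by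
        simp [OnlyCandidate]
    _ = _ := (measurePreserving_fst.measure_preimage
        MeasurableSet.of_discrete.nullMeasurableSet).symm

end Candidate

end Failure

/-! ### One iteration of the algorithm -/

section Powers

variable {c n : ℕ}

theorem inv_pow_le_one : ((n : ℝ) ^ c)⁻¹ ≤ 1 := by
  exact_mod_cast Nat.cast_inv_le_one (α := ℝ) (n ^ c)

theorem sq_mul_inv_pow_three_mul_le (hc : 1 ≤ c) (hn : 1 < n) :
    (n : ℝ) ^ 2 * ((n : ℝ) ^ (3 * c))⁻¹ ≤ 1 / 2 := by
  have hn : (2 : ℝ) ≤ n := by exact_mod_cast hn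
  rw [← div_eq_mul_inv, div_le_div_iff₀ (by positivity) two_pos, one_mul]
  calc (n : ℝ) ^ 2 * 2 ≤ (n : ℝ) ^ 2 * n := by gcongr
    _ = (n : ℝ) ^ 3 := (pow_succ _ _).symm
    _ ≤ (n : ℝ) ^ (3 * c) := pow_le_pow_right₀ (by linarith) (by omega)

theorem inv_pow_three_mul_le (hc : 1 ≤ c) (hn : 1 < n) :
    ((n : ℝ) ^ (3 * c))⁻¹ ≤ 1 / 4 * ((n : ℝ) ^ c)⁻¹ := by
  have hn : (2 : ℝ) ≤ n := by exact_mod_cast hn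
  have hfour : (4 : ℝ) ≤ (n : ℝ) ^ (2 * c) :=
    calc (4 : ℝ) = 2 ^ 2 := by norm_num
      _ ≤ (n : ℝ) ^ 2 := by gcongr
      _ ≤ (n : ℝ) ^ (2 * c) := pow_le_pow_right₀ (by linarith) (by omega)
  rw [show 3 * c = 2 * c + c by ring, pow_add, mul_inv, one_div]
  gcongr

theorem one_third_lt_exp_neg_one : 1 / 3 < Real.exp (-1) :=
  lt_trans (by norm_num) Real.exp_neg_one_gt_d9

end Powers

section Step

variable {V : Type*} [Fintype V]

/-- The coins of one iteration of the algorithm for the network `G`. -/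
abbrev StepCoins (G : Digraph V) (c : ℕ) :=
  IterationCoins V (idLength c (Fintype.card V)) (logSize (Fintype.card V))
    (numRounds (roundFactor c) (Fintype.card V) (eccentricity G))

/-- The law of the coins of one iteration of the algorithm for the network `G`. -/
noncomputable abbrev stepLaw (G : Digraph V) (c : ℕ) : Measure (StepCoins G c) :=
  iterationLaw V (Fintype.card V) _ _ _

/-- The heights of the rounds of Decay in a broadcast in the network `G`. -/
noncomputable abbrev height (G : Digraph V) : ℕ → ℕ :=
  roundHeight (Fintype.card V) (eccentricity G)

/-- One iteration of the algorithm for the network `G`. -/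
noncomputable abbrev step (G : Digraph V) (c : ℕ) (st : V → Status (idLength c (Fintype.card V)))
    (r : StepCoins G c) : V → Status (idLength c (Fintype.card V)) :=
  iteration G (height G) st r

variable [Nontrivial V] {G : Digraph V} {c : ℕ}

theorem measure_exists_multiBroadcast_roundFactor_eq_none_le {M : Type} (hG : StronglyConnected G)
    (c : ℕ) (f : V → Option M) (hf : ∃ v, f v ≠ none) :
    (Measure.pi fun _ : Fin (numRounds (roundFactor c) (Fintype.card V) (eccentricity G)) =>
        decayLaw V (logSize (Fintype.card V)))
          {coins | ∃ v, multiBroadcast G (height G) (fun _ => true) f coins v = none} ≤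
      ENNReal.ofReal (((Fintype.card V : ℝ) ^ (3 * c))⁻¹ / 128) :=
  (measure_exists_multiBroadcast_eq_none_le hG (by unfold roundFactor; omega) hf).trans
    (ENNReal.ofReal_le_ofReal (mul_exp_roundFactor_le c Fintype.one_lt_card))

theorem le_stepLaw_elected (hG : StronglyConnected G) :
    ENNReal.ofReal 0.32 ≤ stepLaw G c {r | Elected (step G c (initial V _) r)} := by
  have hfail : stepLaw G c {r | FirstBroadcastFails G (height G) r} ≤ ENNReal.ofReal 0.01 :=
    (iterationLaw_firstBroadcastFails_le
      (measure_exists_multiBroadcast_roundFactor_eq_none_le hG c)).trans <|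
      ENNReal.ofReal_le_ofReal (by linarith [inv_pow_le_one (c := 3 * c) (n := Fintype.card V)])
  have honly : ENNReal.ofReal 0.33 ≤ stepLaw G c {r | ∃ v, OnlyCandidate r.1 v} :=
    (ENNReal.ofReal_le_ofReal (by linarith [one_third_lt_exp_neg_one])).trans
      le_iterationLaw_exists_onlyCandidate
  have hsub : {r : StepCoins G c | ∃ v, OnlyCandidate r.1 v} ⊆
      {r | Elected (step G c (initial V _) r)} ∪ {r | FirstBroadcastFails G (height G) r} :=
    fun r ⟨v, hv⟩ => or_iff_not_imp_right.2 (elected_iteration_of_onlyCandidate hv)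
  rw [show (0.32 : ℝ) = 0.33 - 0.01 by norm_num, ENNReal.ofReal_sub _ (by norm_num)]
  exact tsub_le_iff_right.2 <| honly.trans <| (measure_mono hsub).trans <|
    (measure_union_le _ _).trans (by gcongr)

theorem stepLaw_ne_initial_and_not_elected_le (hG : StronglyConnected G) :
    stepLaw G c {r | step G c (initial V _) r ≠ initial V _ ∧
        ¬Elected (step G c (initial V _) r)} ≤
      ENNReal.ofReal (65 / 64 * ((Fintype.card V : ℝ) ^ (3 * c))⁻¹) := by
  have hbroadcast := measure_exists_multiBroadcast_roundFactor_eq_none_le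
    (M := BitString (idLength c (Fintype.card V))) hG c
  have hdetect : stepLaw G c {r | DetectionFails G (height G) r} ≤ _ :=
    (iterationLaw_detectionFails_le hG (logSize_pos Fintype.one_lt_card)
      (le_two_pow_logSize _)).trans
      (ENNReal.ofReal_le_ofReal (missRate_pow_idLength_le c Fintype.card_pos))
  have hsub : {r : StepCoins G c | step G c (initial V _) r ≠ initial V _ ∧
        ¬Elected (step G c (initial V _) r)} ⊆
      ({r | FirstBroadcastFails G (height G) r} ∪ {r | DetectionFails G (height G) r}) ∪
        {r | SecondBroadcastFails G (height G) r} := by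
    rintro r ⟨hinitial, helected⟩
    by_contra hr
    simp only [Set.mem_union, Set.mem_ofPred_eq, not_or] at hr
    exact (iteration_initial_eq_or_elected hr.1.1 hr.1.2 hr.2).elim hinitial helected
  calc _ ≤ _ := measure_mono hsub
    _ ≤ _ := (measure_union_le _ _).trans (add_le_add_left (measure_union_le _ _) _)
    _ ≤ _ := add_le_add (add_le_add (iterationLaw_firstBroadcastFails_le hbroadcast) hdetect)
        (iterationLaw_secondBroadcastFails_le hbroadcast)
    _ = _ := by
        rw [← ENNReal.ofReal_add (by positivity) (by positivity),
          ← ENNReal.ofReal_add (by positivity) (by positivity)]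
        ring_nf

end Step

/-! ### The drift of the potentials -/

theorem lintegral_add_mul_le_add_mul {X : Type*} [MeasurableSpace X] [Countable X]
    [MeasurableSingletonClass X] {μ : Measure X} [IsProbabilityMeasure μ] {f : X → ℝ≥0∞}
    {S T : Set X} {a B C : ℝ≥0∞}
    (h : ∀ x, f x + S.indicator (fun _ => a) x ≤ C + T.indicator (fun _ => B) x) :
    ∫⁻ x, f x ∂μ + a * μ S ≤ C + B * μ T := by
  have hlintegral := lintegral_mono (μ := μ) h
  rwa [lintegral_add_right _ .of_discrete, lintegral_add_right _ .of_discrete,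
    lintegral_indicator_const .of_discrete, lintegral_indicator_const .of_discrete, lintegral_const,
    measure_univ, mul_one] at hlintegral

section Running

variable {V : Type*} {b l Q : ℕ} {G : Digraph V} {h : ℕ → ℕ} {st : V → Status b}
  {r : IterationCoins V b l Q}

theorem initial_not_isSome [Nonempty V] : ¬∀ v, (initial V b v).isSome := fun h =>
  (Classical.arbitrary V |> h) |> Bool.noConfusion

theorem iteration_eq_none_imp {v : V} (hv : iteration G h st r v = none) : st v = none := by
  by_contra hst
  exact hst (iteration_of_isSome (Option.isSome_iff_ne_none.2 hst) ▸ hv)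

theorem iteration_ne_initial (hst : st ≠ initial V b) : iteration G h st r ≠ initial V b :=
  fun h => hst (funext fun v => iteration_eq_none_imp (congrFun h v))

variable [Fintype V]

/-- The number of running nodes. -/
def numRunning (st : V → Status b) : ℕ := (Finset.univ.filter fun v => st v = none).card

theorem numRunning_eq_zero (hst : ∀ v, (st v).isSome) : numRunning st = 0 :=
  Finset.card_eq_zero.2 <| Finset.filter_eq_empty_iff.2 fun v _ =>
    Option.isSome_iff_ne_none.1 (hst v)

theorem numRunning_iteration_le : numRunning (iteration G h st r) ≤ numRunning st :=
  Finset.card_le_card <| Finset.monotone_filter_right _ fun _ _ => iteration_eq_none_imp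

theorem numRunning_iteration_lt {v : V} (hst : st v = none) (hv : OnlyCandidate r.1 v) :
    numRunning (iteration G h st r) < numRunning st := by
  refine Finset.card_lt_card <| (Finset.ssubset_iff_of_subset <|
    Finset.monotone_filter_right _ fun _ _ => iteration_eq_none_imp).2 ⟨v, by simpa using hst, ?_⟩
  simpa [Option.isSome_iff_ne_none] using iteration_isSome_of_onlyCandidate hv hst

end Running

section Drift

variable {V : Type*} {b : ℕ}

open Classical in
/-- The indicator function of the states in which some node is running. -/
noncomputable def unfinished (st : V → Status b) : ℝ≥0∞ := if ∀ v, (st v).isSome then 0 else 1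

open Classical in
/-- An upper bound for the expected number of further iterations. -/
noncomputable def iterationBound [Fintype V] (st : V → Status b) : ℝ≥0∞ :=
  if st = initial V b then 8 else 3 * Fintype.card V * numRunning st

open Classical in
/-- An upper bound for the probability that a state is reached from which the algorithm does not
elect a leader. Every state other than the initial one in which no leader is elected counts as
such. -/
noncomputable def errorBound [Fintype V] (c : ℕ) (st : V → Status b) : ℝ≥0∞ :=
  if Elected st then 0
  else if st = initial V b then ENNReal.ofReal ((Fintype.card V : ℝ) ^ c)⁻¹ else 1

variable [Fintype V]

theorem iterationBound_initial : iterationBound (initial V b) = 8 := if_pos rfl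

theorem iterationBound_of_ne {st : V → Status b} (hst : st ≠ initial V b) :
    iterationBound st = 3 * Fintype.card V * numRunning st := if_neg hst

theorem errorBound_of_elected {c : ℕ} {st : V → Status b} (hst : Elected st) :
    errorBound c st = 0 := if_pos hst

theorem errorBound_initial [Nonempty V] {c : ℕ} :
    errorBound c (initial V b) = ENNReal.ofReal ((Fintype.card V : ℝ) ^ c)⁻¹ := by
  rw [errorBound, if_neg fun h => initial_not_isSome h.isSome, if_pos rfl]

theorem errorBound_of_ne {c : ℕ} {st : V → Status b} (hst : ¬Elected st)
    (hne : st ≠ initial V b) : errorBound c st = 1 := by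
  rw [errorBound, if_neg hst, if_neg hne]

theorem errorBound_le_one (c : ℕ) (st : V → Status b) : errorBound c st ≤ 1 := by
  unfold errorBound
  split_ifs
  exacts [zero_le, ENNReal.ofReal_le_one.2 inv_pow_le_one, le_rfl]

variable [Nontrivial V] {G : Digraph V} {c : ℕ}

theorem lintegral_step_initial_add_le (hG : StronglyConnected G)
    {Φ : (V → Status (idLength c (Fintype.card V))) → ℝ≥0∞} {B : ℝ≥0∞}
    (hΦ : ∀ st, Elected st → Φ st = 0) (hB : ∀ st, st ≠ initial V _ → Φ st ≤ B) :
    ∫⁻ r, Φ (step G c (initial V _) r) ∂(stepLaw G c) +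
        Φ (initial V _) * ENNReal.ofReal 0.32 ≤
      Φ (initial V _) +
        B * ENNReal.ofReal (65 / 64 * ((Fintype.card V : ℝ) ^ (3 * c))⁻¹) := by
  classical
  have hpoint (r : StepCoins G c) : Φ (step G c (initial V _) r) +
      {r | Elected (step G c (initial V _) r)}.indicator (fun _ => Φ (initial V _)) r ≤
        Φ (initial V _) + {r | step G c (initial V _) r ≠ initial V _ ∧
          ¬Elected (step G c (initial V _) r)}.indicator (fun _ => B) r := by
    simp only [Set.indicator_apply, Set.mem_ofPred_eq]
    by_cases helected : Elected (step G c (initial V _) r)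
    · simp [helected, hΦ]
    by_cases hinitial : step G c (initial V _) r = initial V _
    · simp only [hinitial, if_neg (hinitial ▸ helected), add_zero, le_self_add]
    · simp only [helected, hinitial, if_false, not_false_eq_true, and_self, Ne, if_true, add_zero]
      exact (hB _ hinitial).trans le_add_self
  calc _ ≤ _ := by gcongr; exact le_stepLaw_elected hG
    _ ≤ _ := lintegral_add_mul_le_add_mul hpoint
    _ ≤ _ := by gcongr; exact stepLaw_ne_initial_and_not_elected_le hG

theorem lintegral_iterationBound_initial_le (hc : 1 ≤ c) (hG : StronglyConnected G) :
    1 + ∫⁻ r, iterationBound (step G c (initial V _) r) ∂(stepLaw G c) ≤ 8 := by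
  have hdrift := lintegral_step_initial_add_le (c := c) hG (Φ := iterationBound)
    (B := ENNReal.ofReal (3 * (Fintype.card V : ℝ) ^ 2))
    (fun st hst => by
      rw [iterationBound_of_ne fun h => initial_not_isSome (h ▸ hst.isSome),
        numRunning_eq_zero hst.isSome, Nat.cast_zero, mul_zero])
    (fun st hst => by
      rw [iterationBound_of_ne hst, ENNReal.ofReal_mul (by norm_num), sq,
        ENNReal.ofReal_mul (Nat.cast_nonneg _), ENNReal.ofReal_natCast, ENNReal.ofReal_ofNat,
        ← mul_assoc]
      gcongr
      exact Finset.card_le_univ _)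
  have hbad : 3 * (Fintype.card V : ℝ) ^ 2 * (65 / 64 * ((Fintype.card V : ℝ) ^ (3 * c))⁻¹) ≤
      1.53 := by
    linarith [sq_mul_inv_pow_three_mul_le hc (Fintype.one_lt_card (α := V))]
  rw [iterationBound_initial, ← ENNReal.ofReal_mul (by positivity)] at hdrift
  refine (ENNReal.add_le_add_iff_right (a := 8 * ENNReal.ofReal 0.32) (by finiteness)).1 ?_
  calc _ ≤ 1 + (8 + ENNReal.ofReal 1.53) := by
        rw [add_assoc]
        refine add_le_add_right (hdrift.trans (add_le_add_right ?_ _)) _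
        exact ENNReal.ofReal_le_ofReal hbad
    _ = ENNReal.ofReal (1 + (8 + 1.53)) := by
        rw [ENNReal.ofReal_add, ENNReal.ofReal_add] <;> norm_num
    _ ≤ ENNReal.ofReal (8 + 8 * 0.32) := ENNReal.ofReal_le_ofReal (by norm_num)
    _ = 8 + 8 * ENNReal.ofReal 0.32 := by
        rw [ENNReal.ofReal_add, ENNReal.ofReal_mul] <;> norm_num

theorem lintegral_iterationBound_le_of_ne {st : V → Status (idLength c (Fintype.card V))}
    (hst : st ≠ initial V _) :
    unfinished st + ∫⁻ r, iterationBound (step G c st r) ∂(stepLaw G c) ≤ iterationBound st := by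
  classical
  simp only [iterationBound_of_ne hst, iterationBound_of_ne (iteration_ne_initial hst)]
  by_cases hall : ∀ v, (st v).isSome
  · rw [unfinished, if_pos hall, zero_add]
    calc _ ≤ ∫⁻ _, (3 * Fintype.card V * numRunning st : ℝ≥0∞) ∂(stepLaw G c) := by
          gcongr
          exact numRunning_iteration_le
      _ = _ := by simp
  obtain ⟨v, hv⟩ : ∃ v, st v = none := by simpa using hall
  have hpoint (r : StepCoins G c) : (3 * Fintype.card V * numRunning (step G c st r) : ℝ≥0∞) +
      {r | OnlyCandidate r.1 v}.indicator (fun _ => (3 * Fintype.card V : ℝ≥0∞)) r ≤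
        3 * Fintype.card V * numRunning st + (∅ : Set _).indicator 0 r := by
    rw [Set.indicator_empty, add_zero]
    by_cases hr : OnlyCandidate r.1 v
    · rw [Set.indicator_of_mem (by exact hr), ← mul_add_one]
      gcongr
      exact_mod_cast numRunning_iteration_lt hv hr
    · rw [Set.indicator_of_notMem (by exact hr), add_zero]
      gcongr
      exact numRunning_iteration_le
  have hprob : 1 ≤ 3 * Fintype.card V * stepLaw G c {r | OnlyCandidate r.1 v} :=
    calc (1 : ℝ≥0∞) ≤ ENNReal.ofReal (3 * Fintype.card V *
          ((Fintype.card V : ℝ)⁻¹ * Real.exp (-1))) := by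
          rw [ENNReal.one_le_ofReal, mul_assoc,
            mul_inv_cancel_left₀ (Nat.cast_ne_zero.2 Fintype.card_ne_zero)]
          linarith [one_third_lt_exp_neg_one]
      _ = 3 * Fintype.card V *
          ENNReal.ofReal ((Fintype.card V : ℝ)⁻¹ * Real.exp (-1)) := by
          rw [ENNReal.ofReal_mul (by positivity), ENNReal.ofReal_mul (by norm_num)]
          simp
      _ ≤ _ := by gcongr; exact le_iterationLaw_onlyCandidate v
  rw [unfinished, if_neg hall, add_comm]
  calc _ ≤ _ := add_le_add_right hprob _
    _ ≤ _ := lintegral_add_mul_le_add_mul hpoint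
    _ = _ := by simp

theorem unfinished_add_lintegral_iterationBound_le (hc : 1 ≤ c) (hG : StronglyConnected G)
    (st : V → Status (idLength c (Fintype.card V))) :
    unfinished st + ∫⁻ r, iterationBound (step G c st r) ∂(stepLaw G c) ≤ iterationBound st := by
  by_cases hst : st = initial V _
  · rw [hst, iterationBound_initial, unfinished, if_neg initial_not_isSome]
    exact lintegral_iterationBound_initial_le hc hG
  · exact lintegral_iterationBound_le_of_ne hst

theorem lintegral_errorBound_initial_le (hc : 1 ≤ c) (hG : StronglyConnected G) :
    ∫⁻ r, errorBound c (step G c (initial V _) r) ∂(stepLaw G c) ≤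
      errorBound c (initial V (idLength c (Fintype.card V))) := by
  have hdrift := lintegral_step_initial_add_le (c := c) hG (Φ := errorBound c)
    (fun _ => errorBound_of_elected) (fun st _ => errorBound_le_one c st)
  have hbad : ENNReal.ofReal (65 / 64 * ((Fintype.card V : ℝ) ^ (3 * c))⁻¹) ≤
      errorBound c (initial V (idLength c (Fintype.card V))) * ENNReal.ofReal 0.32 := by
    have hpos : 0 ≤ ((Fintype.card V : ℝ) ^ c)⁻¹ := by positivity
    rw [errorBound_initial, ← ENNReal.ofReal_mul hpos]
    exact ENNReal.ofReal_le_ofReal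
      (by linarith [inv_pow_three_mul_le hc (Fintype.one_lt_card (α := V))])
  rw [one_mul] at hdrift
  refine (ENNReal.add_le_add_iff_right (ENNReal.mul_ne_top ?_ ENNReal.ofReal_ne_top)).1
    (hdrift.trans (add_le_add_right hbad _))
  exact ne_top_of_le_ne_top ENNReal.one_ne_top (errorBound_le_one c _)

theorem lintegral_errorBound_le (hc : 1 ≤ c) (hG : StronglyConnected G)
    (st : V → Status (idLength c (Fintype.card V))) :
    ∫⁻ r, errorBound c (step G c st r) ∂(stepLaw G c) ≤ errorBound c st := by
  by_cases helected : Elected st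
  · simp [step, helected.iteration_eq]
  by_cases hst : st = initial V _
  · exact hst ▸ lintegral_errorBound_initial_le hc hG
  · rw [errorBound_of_ne helected hst]
    calc _ ≤ ∫⁻ _, (1 : ℝ≥0∞) ∂(stepLaw G c) := lintegral_mono fun r => errorBound_le_one c _
      _ = 1 := by simp

end Drift

/-! ### The whole run -/

section Run

variable {V : Type*} {b l Q : ℕ} {G : Digraph V} {h : ℕ → ℕ}

theorem run_eq_chain (ω : Coins V b l Q) (k : ℕ) :
    run G h ω k = chain (iteration G h) (initial V b) ω k := by
  induction k with
  | zero => rfl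
  | succ k ih => rw [run, chain, ih]

theorem measurable_comp_run [Finite V] (f : (V → Status b) → ℝ≥0∞) (k : ℕ) :
    Measurable fun ω : Coins V b l Q => f (run G h ω k) := by
  let _ : MeasurableSpace (V → Status b) := ⊤
  simp only [run_eq_chain]
  exact Measurable.of_discrete.comp (measurable_chain _ _ k)

theorem runningTime_le_mul_tsum_unfinished {T : ℕ} (hT : T ≠ 0) (ω : Coins V b l Q) :
    runningTime G h T ω ≤ T * ∑' k, unfinished (run G h ω k) := by
  classical
  by_cases hfinite : ∃ k, ∀ v, (run G h ω k v).isSome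
  · have hcount : ∑ k ∈ Finset.range (Nat.find hfinite), unfinished (run G h ω k) =
        Nat.find hfinite := by
      have hrunning : ∀ k ∈ Finset.range (Nat.find hfinite), unfinished (run G h ω k) = 1 :=
        fun k hk => if_neg (Nat.find_min hfinite (Finset.mem_range.1 hk))
      simp [Finset.sum_congr rfl hrunning]
    calc runningTime G h T ω ≤ (T * Nat.find hfinite : ℕ) :=
          iInf₂_le (Nat.find hfinite) (Nat.find_spec hfinite)
      _ = T * ∑ k ∈ Finset.range (Nat.find hfinite), unfinished (run G h ω k) := by
          rw [Nat.cast_mul, hcount]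
      _ ≤ _ := by gcongr; exact ENNReal.sum_le_tsum _
  · have hunfinished (k : ℕ) : unfinished (run G h ω k) = 1 := if_neg fun hk => hfinite ⟨k, hk⟩
    simp [hunfinished, ENNReal.mul_top, hT]

end Run

section Expectation

theorem iterationSteps_ne_zero {c n : ℕ} (hc : 1 ≤ c) (hn : 1 < n) (K D : ℕ) :
    iterationSteps c K n D ≠ 0 := by
  have hlog := logSize_pos hn
  have : 0 < idLength c n * 4 * logSize n := by unfold idLength; positivity
  unfold iterationSteps
  omega

variable {V : Type*} [Fintype V]

/-- The law of the coins of the algorithm in the network `G`, with the constant `K` of the theorem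
set to `roundFactor c`. -/
noncomputable abbrev runLaw (G : Digraph V) (c : ℕ) :
    Measure (Coins V (idLength c (Fintype.card V)) (logSize (Fintype.card V))
      (numRounds (roundFactor c) (Fintype.card V) (eccentricity G))) :=
  algorithmLaw c (roundFactor c) (Fintype.card V) (eccentricity G) V

instance (G : Digraph V) (c : ℕ) : IsProbabilityMeasure (runLaw G c) := by
  unfold runLaw algorithmLaw; infer_instance

theorem one_le_indicator_elected_add {b : ℕ} [Nonempty V] (c : ℕ) (st : V → Status b) :
    1 ≤ {st | Elected st}.indicator 1 st + (errorBound c st + unfinished st) := by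
  by_cases helected : Elected st
  · simp [Set.indicator_of_mem (show st ∈ {st | Elected st} from helected)]
  by_cases hinitial : st = initial V b
  · rw [hinitial, unfinished, if_neg initial_not_isSome, ← add_assoc]
    exact le_add_self
  · rw [errorBound_of_ne helected hinitial]
    exact le_self_add.trans le_add_self

variable [Nontrivial V] {G : Digraph V} {c : ℕ}

theorem tsum_lintegral_unfinished_le (hc : 1 ≤ c) (hG : StronglyConnected G) :
    ∑' k, ∫⁻ ω, unfinished (run G (height G) ω k) ∂(runLaw G c) ≤ 8 := by
  simp only [run_eq_chain]
  exact (tsum_lintegral_chain_le (stepLaw G c) (step G c) (initial V _) unfinished iterationBound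
    (unfinished_add_lintegral_iterationBound_le hc hG)).trans_eq iterationBound_initial

theorem lintegral_runningTime_le (hc : 1 ≤ c) (hG : StronglyConnected G) :
    ∫⁻ ω, runningTime G (height G)
        (iterationSteps c (roundFactor c) (Fintype.card V) (eccentricity G)) ω ∂(runLaw G c) ≤
      iterationSteps c (roundFactor c) (Fintype.card V) (eccentricity G) * 8 := by
  set T := iterationSteps c (roundFactor c) (Fintype.card V) (eccentricity G)
  calc _ ≤ ∫⁻ ω, T * ∑' k, unfinished (run G (height G) ω k) ∂(runLaw G c) :=
        lintegral_mono <| runningTime_le_mul_tsum_unfinished <|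
          iterationSteps_ne_zero hc Fintype.one_lt_card _ _
    _ = T * ∑' k, ∫⁻ ω, unfinished (run G (height G) ω k) ∂(runLaw G c) := by
        rw [lintegral_const_mul _ (.tsum fun k => measurable_comp_run _ k),
          lintegral_tsum fun k => (measurable_comp_run _ k).aemeasurable]
    _ ≤ T * 8 := by gcongr; exact tsum_lintegral_unfinished_le hc hG

theorem lintegral_errorBound_run_le (hc : 1 ≤ c) (hG : StronglyConnected G) (k : ℕ) :
    ∫⁻ ω, errorBound c (run G (height G) ω k) ∂(runLaw G c) ≤
      ENNReal.ofReal ((Fintype.card V : ℝ) ^ c)⁻¹ := by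
  simp only [run_eq_chain]
  exact (lintegral_chain_le (stepLaw G c) (step G c) (initial V _) (errorBound c)
    (lintegral_errorBound_le hc hG) k).trans_eq errorBound_initial

theorem one_le_runLaw_electsLeader_add (hc : 1 ≤ c) (hG : StronglyConnected G) (k : ℕ) :
    1 ≤ runLaw G c {ω | ElectsLeader G (height G) ω} +
      (ENNReal.ofReal ((Fintype.card V : ℝ) ^ c)⁻¹ +
        ∫⁻ ω, unfinished (run G (height G) ω k) ∂(runLaw G c)) := by
  calc (1 : ℝ≥0∞) = ∫⁻ _, 1 ∂(runLaw G c) := by simp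
    _ ≤ ∫⁻ ω, {st | Elected st}.indicator 1 (run G (height G) ω k) +
          (errorBound c (run G (height G) ω k) + unfinished (run G (height G) ω k))
            ∂(runLaw G c) := lintegral_mono fun _ => one_le_indicator_elected_add c _
    _ = ∫⁻ ω, {ω | Elected (run G (height G) ω k)}.indicator 1 ω ∂(runLaw G c) +
          (∫⁻ ω, errorBound c (run G (height G) ω k) ∂(runLaw G c) +
            ∫⁻ ω, unfinished (run G (height G) ω k) ∂(runLaw G c)) := by
        rw [lintegral_add_left (measurable_comp_run _ k),
          lintegral_add_left (measurable_comp_run _ k)]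
        rfl
    _ ≤ _ := by
        gcongr
        · refine (lintegral_indicator_one_le _).trans (measure_mono ?_)
          exact fun ω ⟨y, hy⟩ => ⟨k, y, hy⟩
        · exact lintegral_errorBound_run_le hc hG k

theorem le_runLaw_electsLeader (hc : 1 ≤ c) (hG : StronglyConnected G) :
    ENNReal.ofReal (1 - 1 / (Fintype.card V : ℝ) ^ c) ≤
      runLaw G c {ω | ElectsLeader G (height G) ω} := by
  have htendsto : Filter.Tendsto
      (fun k => ∫⁻ ω, unfinished (run G (height G) ω k) ∂(runLaw G c)) Filter.atTop (nhds 0) :=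
    ENNReal.tendsto_atTop_zero_of_tsum_ne_top <|
      ne_top_of_le_ne_top (by simp) (tsum_lintegral_unfinished_le hc hG)
  have hlimit := ge_of_tendsto' ((htendsto.const_add _).const_add _)
    (one_le_runLaw_electsLeader_add hc hG)
  rw [add_zero] at hlimit
  rw [ENNReal.ofReal_sub _ (by positivity), ENNReal.ofReal_one, one_div]
  exact tsub_le_iff_right.2 hlimit

end Expectation

/-! ### The length of an iteration -/

theorem sum_padicValNat_succ_le (Q : ℕ) :
    ∑ q ∈ Finset.range Q, padicValNat 2 (q + 1) ≤ Q := by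
  have hfactorial : ∑ q ∈ Finset.range Q, padicValNat 2 (q + 1) = padicValNat 2 Q.factorial := by
    induction Q with
    | zero => simp
    | succ Q ih =>
      rw [Finset.sum_range_succ, ih, Nat.factorial_succ,
        padicValNat.mul (by omega) (Nat.factorial_ne_zero Q), add_comm]
  have hlegendre := sub_one_mul_padicValNat_factorial (p := 2) Q
  omega

theorem sum_range_ite_mod_eq_zero_le (g l Q : ℕ) :
    ∑ q ∈ Finset.range Q, (if q % g = 0 then l else 0) ≤ (Q / g + 1) * l := by
  rw [← Finset.sum_filter, Finset.sum_const, smul_eq_mul]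
  gcongr
  calc ((Finset.range Q).filter fun q => q % g = 0).card
      ≤ ((Finset.range (Q / g + 1)).image (g * ·)).card := by
        refine Finset.card_le_card fun q hq => ?_
        obtain ⟨hq, hmod⟩ := Finset.mem_filter.1 hq
        refine Finset.mem_image.2 ⟨q / g, ?_, Nat.mul_div_cancel' (Nat.dvd_of_mod_eq_zero hmod)⟩
        exact Finset.mem_range_succ_iff.2 (Nat.div_le_div_right (Finset.mem_range.1 hq).le)
    _ ≤ Q / g + 1 := Finset.card_image_le.trans_eq (Finset.card_range _)

theorem logRatio_pos (n D : ℕ) : 0 < logRatio n D := Nat.succ_pos _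

theorem logSize_le_fullPeriod_mul_logRatio (n D : ℕ) :
    logSize n ≤ fullPeriod n D * logRatio n D :=
  (Nat.lt_div_mul_add (logRatio_pos n D)).le.trans_eq (Nat.succ_mul _ _).symm

theorem logRatio_le_logSize_add_one (n D : ℕ) : logRatio n D ≤ logSize n + 1 :=
  Nat.succ_le_succ <| (Nat.log_mono_right (Nat.div_le_self n D)).trans (Nat.log_le_clog 2 n)

theorem broadcastSteps_le (K n D : ℕ) :
    broadcastSteps K n D ≤ 3 * (logRatio n D * numRounds K n D) + logSize n := by
  set Q := numRounds K n D
  have hsplit : broadcastSteps K n D ≤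
      ∑ q ∈ Finset.range Q, (if q % fullPeriod n D = 0 then logSize n else 0) +
        (Q * logRatio n D + ∑ q ∈ Finset.range Q, padicValNat 2 (q + 1)) := by
    calc _ ≤ ∑ q ∈ Finset.range Q, ((if q % fullPeriod n D = 0 then logSize n else 0) +
          (logRatio n D + padicValNat 2 (q + 1))) := by
          refine Finset.sum_le_sum fun q _ => ?_
          unfold roundHeight
          split_ifs
          exacts [le_self_add, (min_le_right _ _).trans le_add_self]
      _ = _ := by
          rw [Finset.sum_add_distrib, Finset.sum_add_distrib, Finset.sum_const, Finset.card_range,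
            smul_eq_mul]
  have hfull : Q / fullPeriod n D * logSize n ≤ Q * logRatio n D :=
    calc _ ≤ Q / fullPeriod n D * (fullPeriod n D * logRatio n D) := by
          gcongr; exact logSize_le_fullPeriod_mul_logRatio n D
      _ = Q / fullPeriod n D * fullPeriod n D * logRatio n D := (mul_assoc _ _ _).symm
      _ ≤ Q * logRatio n D := by gcongr; exact Nat.div_mul_le_self _ _
  have hperiodic := sum_range_ite_mod_eq_zero_le (fullPeriod n D) (logSize n) Q
  have hvaluation := sum_padicValNat_succ_le Q
  have hQ : Q ≤ Q * logRatio n D := Nat.le_mul_of_pos_right _ (logRatio_pos n D)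
  rw [add_mul, one_mul] at hperiodic
  rw [mul_comm (logRatio n D) Q]
  omega

theorem logRatio_mul_fullPeriod_le {n : ℕ} (hn : 1 < n) (D : ℕ) :
    logRatio n D * fullPeriod n D ≤ 3 * logSize n := by
  have hdiv := Nat.mul_div_le (logSize n) (logRatio n D)
  have hratio := logRatio_le_logSize_add_one n D
  have hlog := logSize_pos hn
  rw [fullPeriod, mul_add, mul_one]
  omega

theorem logRatio_mul_numRounds_le {n : ℕ} (hn : 1 < n) (K D : ℕ) :
    logRatio n D * numRounds K n D ≤ K * (D * logRatio n D + 3 * logSize n ^ 2) :=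
  calc _ = K * (D * logRatio n D + logSize n * (logRatio n D * fullPeriod n D)) := by
        rw [numRounds]; ring
    _ ≤ K * (D * logRatio n D + logSize n * (3 * logSize n)) := by
        gcongr _ * (_ + _ * ?_); exact logRatio_mul_fullPeriod_le hn D
    _ = _ := by ring

theorem iterationSteps_le {n : ℕ} (hn : 1 < n) (c K D : ℕ) :
    iterationSteps c K n D ≤ (18 * K + 64 * c + 2) * (D * logRatio n D + logSize n ^ 2) := by
  have hlog : logSize n ≤ logSize n ^ 2 := Nat.le_self_pow (by norm_num) _
  calc iterationSteps c K n D ≤ 2 * (3 * (K * (D * logRatio n D + 3 * logSize n ^ 2)) +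
          logSize n ^ 2) + 16 * c * logSize n * 4 * logSize n := by
        unfold iterationSteps idLength
        gcongr
        refine (broadcastSteps_le K n D).trans ?_
        gcongr 3 * ?_ + ?_
        exact logRatio_mul_numRounds_le hn K D
    _ = 6 * K * (D * logRatio n D) + (18 * K + 64 * c + 2) * logSize n ^ 2 := by ring
    _ ≤ _ := by rw [mul_add]; gcongr; omega

theorem logSize_le_two_mul_logb {n : ℕ} (hn : 1 < n) : (logSize n : ℝ) ≤ 2 * Real.logb 2 n := by
  have hone : (1 : ℝ) ≤ Real.logb 2 n := by
    rw [Real.le_logb_iff_rpow_le (by norm_num) (by positivity), Real.rpow_one]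
    exact_mod_cast hn
  have hceil : (logSize n : ℝ) < Real.logb 2 n + 1 := by
    rw [logSize, ← Real.natCeil_logb_natCast, Nat.cast_ofNat]
    exact Nat.ceil_lt_add_one (by linarith)
  linarith

theorem logRatio_le_two_mul_max (n D : ℕ) :
    (logRatio n D : ℝ) ≤ 2 * max 1 (Real.logb 2 ((n : ℝ) / D)) := by
  have hlog : (Nat.log 2 (n / D) : ℝ) ≤ max 1 (Real.logb 2 ((n : ℝ) / D)) := by
    rcases Nat.eq_zero_or_pos (n / D) with hzero | hpos
    · simp [hzero]
    · calc (Nat.log 2 (n / D) : ℝ) ≤ Real.logb 2 (n / D : ℕ) := Real.natLog_le_logb _ _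
        _ ≤ Real.logb 2 ((n : ℝ) / D) :=
          Real.logb_le_logb_of_le (by norm_num) (by exact_mod_cast hpos) Nat.cast_div_le
        _ ≤ _ := le_max_right _ _
  rw [logRatio, Nat.cast_succ]
  linarith [le_max_left 1 (Real.logb 2 ((n : ℝ) / D))]

theorem iterationSteps_le_logb {n : ℕ} (hn : 1 < n) (c K D : ℕ) :
    (iterationSteps c K n D : ℝ) ≤ 4 * (18 * K + 64 * c + 2) *
      (D * max 1 (Real.logb 2 ((n : ℝ) / D)) + Real.logb 2 n ^ 2) := by
  have hratio : (D : ℝ) * logRatio n D ≤ 4 * (D * max 1 (Real.logb 2 ((n : ℝ) / D))) := by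
    nlinarith [logRatio_le_two_mul_max n D, Nat.cast_nonneg (α := ℝ) D]
  have hlog : (logSize n : ℝ) ^ 2 ≤ 4 * Real.logb 2 n ^ 2 :=
    calc _ ≤ (2 * Real.logb 2 n) ^ 2 := by gcongr; exact logSize_le_two_mul_logb hn
      _ = _ := by ring
  calc (iterationSteps c K n D : ℝ)
      ≤ (18 * K + 64 * c + 2) * (D * logRatio n D + (logSize n : ℝ) ^ 2) := by
        exact_mod_cast iterationSteps_le hn c K D
    _ ≤ (18 * K + 64 * c + 2) * (4 * (D * max 1 (Real.logb 2 ((n : ℝ) / D))) +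
          4 * Real.logb 2 n ^ 2) := by gcongr
    _ = _ := by ring

end RadioLE

theorem theorem1 (c : ℕ) (hc : 1 ≤ c) :
    ∃ (K : ℕ) (A : ℝ), ∀ (V : Type*) [Fintype V] (G : Digraph V) (n D : ℕ),
      RadioLE.StronglyConnected G → n = Fintype.card V → 2 ≤ n → D = RadioLE.eccentricity G →
        (∫⁻ ω, RadioLE.runningTime G (RadioLE.roundHeight n D) (RadioLE.iterationSteps c K n D) ω
            ∂(RadioLE.algorithmLaw c K n D V) ≤
          ENNReal.ofReal
            (A * (D * max 1 (Real.logb 2 ((n : ℝ) / D)) + Real.logb 2 n ^ 2))) ∧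
        (ENNReal.ofReal (1 - 1 / (n : ℝ) ^ c) ≤
          RadioLE.algorithmLaw c K n D V
            {ω | RadioLE.ElectsLeader G (RadioLE.roundHeight n D) ω}) := by
  refine ⟨RadioLE.roundFactor c, 8 * (4 * (18 * RadioLE.roundFactor c + 64 * c + 2)), ?_⟩
  rintro V _ G n D hG rfl hn rfl
  have : Nontrivial V := Fintype.one_lt_card_iff_nontrivial.1 hn
  refine ⟨(RadioLE.lintegral_runningTime_le hc hG).trans ?_, RadioLE.le_runLaw_electsLeader hc hG⟩
  rw [mul_comm, mul_assoc 8, ENNReal.ofReal_mul (by norm_num), ENNReal.ofReal_ofNat,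
    ← ENNReal.ofReal_natCast]
  gcongr
  exact RadioLE.iterationSteps_le_logb hn c _ _
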